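/- All links are unoriented links in $3$-space, considered up to ambient isotopy and given by diagrams. **Positive Thompson links.** The Thompson group $F$ is the group of all piecewise affine orientation-preserving homeomorphisms of $[0,1]$ with slopes powers of $2$ and dyadic breakpoints. For $n\ge 0$ let $x_n\in F$ be the identity on $[0,1-2^{-n}]$ and map $[1-d,1-\tfrac d2]$, $[1-\tfrac d2,1-\tfrac d4]$, $[1-\tfrac d4,1]$, where $d=2^{-n}$, affinely onto $[1-d,1-\tfrac{3d}4]$, $[1-\tfrac{3d}4,1-\tfrac d2]$, $[1-\tfrac d2,1]$. The positive monoid $F_+\subset F$ is the submonoid generated by $x_0,x_1,x_2,\dots$. A finite rooted plane binary tree describes a dyadic subdivision of $[0,1]$ (leaves are intervals, each trivalent vertex halves an interval), and a pair $\frac{T_+}{T_-}$ of such trees with equal numbers of leaves represents the element of $F$ that maps the $i$-th interval of $T_-$ affinely onto the $i$-th interval of $T_+$, for all $i$. Given such a pair with $n$ leaves each, place $T_+$ in the upper half plane with its leaves on the horizontal axis and its root at the top. From each trivalent vertex add a new strand down to the axis, between the two branches at that vertex. Turn the resulting $4$-valent vertex into a crossing in which the strand joining the two branches passes over the strand formed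 by the new strand and the edge towards the root. Finally extend the strand sprouting from the root to a point of the axis to the left of all others. This gives a tangle with $2n$ ends on the axis. Draw $T_-$ in the lower half plane by the mirror-symmetric construction (again with the strand joining the two branches on top), and glue the two tangles along the axis; the result is the link $\mathcal L(T_+,T_-)$. An element of $F_+$ is represented by a pair whose bottom tree $T_-$ has all its trivalent vertices along its right edge. The *positive Thompson links* are the links $\mathcal L(T_+,T_-)$ of pairs of this form that represent elements of $F_+$. **Arborescent tangles.** Let $t$ be a finite plane rooted tree with integer vertex weights. A vertex of weight $w$ at even distance from the root gives a horizontal twist region with $|w|$ crossings (two horizontal lines if $w=0$), and one at odd distance gives a vertical twist region with $|w|$ crossings (two vertical lines if $w=0$). For $w>0$ (resp. $w<0$) the strand from the bottom left to the top right is above (resp. below) the other strand at each of these crossings. The tangle of a branch starting at even distance from the root is obtained by putting the twist region of its first vertex and the tangles of the branches at this vertex side by side, from left to right in their order; at odd distance they are put on top of each other, from top to bottom. The tangle of the whole tree is the arborescent tangle associated with $t$; its closure is the link obtained by joining its two upper ends and joining its two lower ends. The weighted tree $t$ is *bipartite* if all weights are $\pm1$, adjacent vertices have opposite weights, the root and all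 leaves have weight $-1$, and every vertex of weight $+1$ has degree $2$. **Theorem.** The set of positive Thompson links coincides with the set of closures of arborescent tangles associated with bipartite trees. -/

import Mathlib

/-! ## Link diagrams and links

A tangle diagram in general position with respect to the height function is cut by horizontal lines
into slices, read from bottom to top.  Each slice has vertical strands and exactly one elementary
piece: a local minimum (`cup`), a local maximum (`cap`), or a crossing.  In a crossing `pos` the
strand going from the bottom left to the top right is above the other strand; in a crossing `neg`
it is below the other strand. -/

inductive Piece
  | cup
  | cap
  | pos
  | neg
  deriving DecidableEq

namespace Piece

/-- Number of ends at the bottom. -/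
def ins : Piece → ℕ
  | cup => 0
  | cap => 2
  | pos => 2
  | neg => 2

/-- Number of ends at the top. -/
def outs : Piece → ℕ
  | cup => 2
  | cap => 0
  | pos => 2
  | neg => 2

/-- The image of a piece under the reflection of the plane in a horizontal line; the height above
the plane of projection is kept, so the upper strand of a crossing stays the upper strand. -/
def flip : Piece → Piece
  | cup => cap
  | cap => cup
  | pos => neg
  | neg => pos

end Piece

/-- A slice: an elementary piece with `left` vertical strands to the left of it.  The number of
strands to the right is determined by the total number of strands at that height. -/
structure Slice where
  left : ℕ
  piece : Piece

/-- A word of slices, read from bottom to top. -/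
abbrev Word := List Slice

/-- `IsTangle m w n`: the word `w` is a tangle diagram with `m` ends at the bottom and `n` ends
at the top. -/
def IsTangle : ℕ → Word → ℕ → Prop
  | m, [], n => m = n
  | m, s :: w, n =>
      ∃ k, m = s.left + s.piece.ins + k ∧ IsTangle (s.left + s.piece.outs + k) w n

/-- A word put to the right of `k` vertical strands. -/
def Word.shift (k : ℕ) (w : Word) : Word :=
  w.map fun s => ⟨s.left + k, s.piece⟩

/-- The image of a diagram under the reflection of the plane in a horizontal line (with the upper
strand of each crossing remaining the upper strand). -/
def Word.vflip (w : Word) : Word :=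
  (w.map fun s => (⟨s.left, s.piece.flip⟩ : Slice)).reverse

/-- The local moves between sliced diagrams: planar isotopies and Reidemeister moves. -/
inductive Move : Word → Word → Prop
  /-- Two pieces side by side exchange their heights. -/
  | exchange (i k : ℕ) (p q : Piece) :
      Move [⟨i, p⟩, ⟨i + p.outs + k, q⟩] [⟨i + p.ins + k, q⟩, ⟨i, p⟩]
  /-- A minimum and a maximum of one strand cancel. -/
  | zigzag_right (i : ℕ) : Move [⟨i, .cup⟩, ⟨i + 1, .cap⟩] []
  | zigzag_left (i : ℕ) : Move [⟨i + 1, .cup⟩, ⟨i, .cap⟩] []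
  /-- A strand crossing one leg of a maximum is moved to the other leg. -/
  | slide_cap_pos (i : ℕ) : Move [⟨i + 1, .pos⟩, ⟨i, .cap⟩] [⟨i, .neg⟩, ⟨i + 1, .cap⟩]
  | slide_cap_neg (i : ℕ) : Move [⟨i + 1, .neg⟩, ⟨i, .cap⟩] [⟨i, .pos⟩, ⟨i + 1, .cap⟩]
  /-- A strand crossing one leg of a minimum is moved to the other leg. -/
  | slide_cup_pos (i : ℕ) : Move [⟨i, .cup⟩, ⟨i + 1, .pos⟩] [⟨i + 1, .cup⟩, ⟨i, .neg⟩]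
  | slide_cup_neg (i : ℕ) : Move [⟨i, .cup⟩, ⟨i + 1, .neg⟩] [⟨i + 1, .cup⟩, ⟨i, .pos⟩]
  /-- First Reidemeister move. -/
  | reidemeister_one_cap_pos (i : ℕ) : Move [⟨i, .pos⟩, ⟨i, .cap⟩] [⟨i, .cap⟩]
  | reidemeister_one_cap_neg (i : ℕ) : Move [⟨i, .neg⟩, ⟨i, .cap⟩] [⟨i, .cap⟩]
  | reidemeister_one_cup_pos (i : ℕ) : Move [⟨i, .cup⟩, ⟨i, .pos⟩] [⟨i, .cup⟩]
  | reidemeister_one_cup_neg (i : ℕ) : Move [⟨i, .cup⟩, ⟨i, .neg⟩] [⟨i, .cup⟩]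
  /-- Second Reidemeister move. -/
  | reidemeister_two_pos_neg (i : ℕ) : Move [⟨i, .pos⟩, ⟨i, .neg⟩] []
  | reidemeister_two_neg_pos (i : ℕ) : Move [⟨i, .neg⟩, ⟨i, .pos⟩] []
  /-- Third Reidemeister move. -/
  | reidemeister_three_pos (i : ℕ) :
      Move [⟨i, .pos⟩, ⟨i + 1, .pos⟩, ⟨i, .pos⟩] [⟨i + 1, .pos⟩, ⟨i, .pos⟩, ⟨i + 1, .pos⟩]
  | reidemeister_three_neg (i : ℕ) :
      Move [⟨i, .neg⟩, ⟨i + 1, .neg⟩, ⟨i, .neg⟩] [⟨i + 1, .neg⟩, ⟨i, .neg⟩, ⟨i + 1, .neg⟩]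

/-- A (unoriented) link diagram: a tangle diagram without ends. -/
def LinkDiagram := {w : Word // IsTangle 0 w 0}

/-- One local move inside a link diagram. -/
def LinkDiagram.Step (D E : LinkDiagram) : Prop :=
  ∃ a b l r : Word, Move l r ∧ D.1 = a ++ l ++ b ∧ E.1 = a ++ r ++ b

/-- Unoriented links up to isotopy: link diagrams modulo the equivalence relation generated by
planar isotopy and the Reidemeister moves. -/
def Link := Quot LinkDiagram.Step

/-- The isotopy class of the link with a given diagram. -/
def LinkDiagram.toLink (D : LinkDiagram) : Link := Quot.mk _ D

theorem IsTangle.append {w v : Word} {m n p : ℕ} (hw : IsTangle m w n) (hv : IsTangle n v p) :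
    IsTangle m (w ++ v) p := by
  induction w generalizing m with
  | nil => cases hw; exact hv
  | cons s w ih =>
    obtain ⟨k, hk, h⟩ := hw
    exact ⟨k, hk, ih h⟩

theorem IsTangle.add_right {w : Word} {m n : ℕ} (r : ℕ) (hw : IsTangle m w n) :
    IsTangle (m + r) w (n + r) := by
  induction w generalizing m with
  | nil => cases hw; rfl
  | cons s w ih =>
    obtain ⟨k, hk, h⟩ := hw
    refine ⟨k + r, by omega, ?_⟩
    have := ih h
    rwa [add_assoc] at this

theorem IsTangle.shift {w : Word} {m n : ℕ} (r : ℕ) (hw : IsTangle m w n) :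
    IsTangle (m + r) (w.shift r) (n + r) := by
  induction w generalizing m with
  | nil => cases hw; rfl
  | cons s w ih =>
    obtain ⟨k, hk, h⟩ := hw
    refine ⟨k, by simp only; omega, ?_⟩
    have := ih h
    have e : s.left + r + s.piece.outs + k = s.left + s.piece.outs + k + r := by omega
    rw [← e] at this
    exact this

theorem IsTangle.vflip {w : Word} {m n : ℕ} (hw : IsTangle m w n) :
    IsTangle n w.vflip m := by
  induction w generalizing m with
  | nil => cases hw; rfl
  | cons s w ih =>
    obtain ⟨k, hk, h⟩ := hw
    have h1 := ih h
    have h2 : IsTangle (s.left + s.piece.outs + k) [(⟨s.left, s.piece.flip⟩ : Slice)] m := by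
      refine ⟨k, ?_, ?_⟩
      · rcases s with ⟨i, _ | _ | _ | _⟩ <;> rfl
      · rcases s with ⟨i, _ | _ | _ | _⟩ <;> exact hk.symm
    have h3 := h1.append h2
    simpa [Word.vflip] using h3

/-! ## Plane rooted trees with integer weights and their arborescent tangles -/

/-- Finite plane rooted trees with integer vertex weights: the root with its weight, and the
branches at the root in their order. -/
inductive WTree
  | node (weight : ℤ) (children : List WTree)

/-- The weight of the root. -/
def WTree.weight : WTree → ℤ
  | node w _ => w

/-! A four-ended tangle is a word with two ends at the bottom (SW and SE) and two ends at the top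
(NW and NE). -/

/-- The tangle consisting of two horizontal lines. -/
def horizontalLines : Word := [⟨0, .cap⟩, ⟨0, .cup⟩]

/-- The tangle consisting of two vertical lines. -/
def verticalLines : Word := []

/-- The tangle with a single crossing, of sign `+` if `0 < w` and of sign `-` otherwise. -/
def crossing (w : ℤ) : Word := if 0 < w then [⟨0, .pos⟩] else [⟨0, .neg⟩]

/-- Horizontal composition: `A` to the left of `B`; NE and SE of `A` are joined with NW and SW
of `B`. -/
def beside (A B : Word) : Word := ⟨1, .cup⟩ :: (A ++ B.shift 2 ++ [⟨1, .cap⟩])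

/-- Vertical composition: `A` on top of `B`; SW and SE of `A` are joined with NW and NE of `B`. -/
def above (A B : Word) : Word := B ++ A

/-- Horizontal twist region with `|w|` crossings; two horizontal lines if `w = 0`. -/
def horizontalTwist (w : ℤ) : Word := (beside (crossing w))^[w.natAbs] horizontalLines

/-- Vertical twist region with `|w|` crossings; two vertical lines if `w = 0`. -/
def verticalTwist (w : ℤ) : Word := (above (crossing w))^[w.natAbs] verticalLines

mutual

/-- The tangle of a weighted tree whose root is a horizontal twist region: this twist region and
the tangles of the branches, whose roots are vertical twist regions, are put side by side from left
to right. -/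
def WTree.horizontal : WTree → Word
  | .node w ts => beside (horizontalTwist w) (besideAll ts)

/-- The tangles of the trees in a list, starting with vertical twist regions, from left to right. -/
def besideAll : List WTree → Word
  | [] => horizontalLines
  | t :: ts => beside t.vertical (besideAll ts)

/-- The tangle of a weighted tree whose root is a vertical twist region: this twist region and the
tangles of the branches, whose roots are horizontal twist regions, are put on top of each other from
top to bottom. -/
def WTree.vertical : WTree → Word
  | .node w ts => above (verticalTwist w) (aboveAll ts)

/-- The tangles of the trees in a list, starting with horizontal twist regions, from top to
bottom. -/
def aboveAll : List WTree → Word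
  | [] => verticalLines
  | t :: ts => above t.horizontal (aboveAll ts)

end

/-- The arborescent tangle associated with a weighted plane rooted tree; the root is a horizontal
twist region. -/
def WTree.tangle (t : WTree) : Word := t.horizontal

/-- The closure of a four-ended tangle: NW is joined with NE, and SW with SE. -/
def closureWord (A : Word) : Word := ⟨0, .cup⟩ :: (A ++ [⟨0, .cap⟩])

theorem isTangle_horizontalLines : IsTangle 2 horizontalLines 2 :=
  ⟨0, rfl, 0, rfl, rfl⟩

theorem isTangle_crossing (w : ℤ) : IsTangle 2 (crossing w) 2 := by
  unfold crossing
  split_ifs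
  · exact ⟨0, rfl, rfl⟩
  · exact ⟨0, rfl, rfl⟩

theorem IsTangle.beside {A B : Word} (hA : IsTangle 2 A 2) (hB : IsTangle 2 B 2) :
    IsTangle 2 (beside A B) 2 := by
  refine ⟨1, rfl, ?_⟩
  exact ((hA.add_right 2).append (hB.shift 2)).append ⟨1, rfl, rfl⟩

theorem IsTangle.above {A B : Word} (hA : IsTangle 2 A 2) (hB : IsTangle 2 B 2) :
    IsTangle 2 (above A B) 2 :=
  hB.append hA

theorem isTangle_horizontalTwist (w : ℤ) : IsTangle 2 (horizontalTwist w) 2 := by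
  unfold horizontalTwist
  induction w.natAbs with
  | zero => exact isTangle_horizontalLines
  | succ n ih =>
    rw [Function.iterate_succ_apply']
    exact (isTangle_crossing w).beside ih

theorem isTangle_verticalTwist (w : ℤ) : IsTangle 2 (verticalTwist w) 2 := by
  unfold verticalTwist
  induction w.natAbs with
  | zero => rfl
  | succ n ih =>
    rw [Function.iterate_succ_apply']
    exact (isTangle_crossing w).above ih

mutual

theorem WTree.isTangle_horizontal : ∀ t : WTree, IsTangle 2 t.horizontal 2
  | .node w ts => by
    rw [WTree.horizontal]
    exact (isTangle_horizontalTwist w).beside (isTangle_besideAll ts)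

theorem isTangle_besideAll : ∀ ts : List WTree, IsTangle 2 (besideAll ts) 2
  | [] => by
    rw [besideAll]
    exact isTangle_horizontalLines
  | t :: ts => by
    rw [besideAll]
    exact t.isTangle_vertical.beside (isTangle_besideAll ts)

theorem WTree.isTangle_vertical : ∀ t : WTree, IsTangle 2 t.vertical 2
  | .node w ts => by
    rw [WTree.vertical]
    exact (isTangle_verticalTwist w).above (isTangle_aboveAll ts)

theorem isTangle_aboveAll : ∀ ts : List WTree, IsTangle 2 (aboveAll ts) 2
  | [] => by
    rw [aboveAll]
    rfl
  | t :: ts => by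
    rw [aboveAll]
    exact t.isTangle_horizontal.above (isTangle_aboveAll ts)

end

/-- The closure of the arborescent tangle associated with a weighted plane rooted tree. -/
def WTree.closure (t : WTree) : LinkDiagram :=
  ⟨closureWord t.tangle, 0, rfl, t.isTangle_horizontal.append ⟨0, rfl, rfl⟩⟩

/-- The conditions on a bipartite tree at all vertices of a branch: the weight is `1` or `-1`,
neighbouring vertices have opposite weights, leaves have weight `-1`, and a vertex of weight `1`
has degree two, that is, exactly one child besides its parent. -/
inductive WTree.BipartiteBranch : WTree → Prop
  | node (w : ℤ) (ts : List WTree)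
      (sign : w = 1 ∨ w = -1)
      (opposite : ∀ t ∈ ts, t.weight = -w)
      (leaf : ts = [] → w = -1)
      (degree : w = 1 → ts.length = 1)
      (branches : ∀ t ∈ ts, t.BipartiteBranch) :
      (WTree.node w ts).BipartiteBranch

/-- Bipartite weighted plane rooted trees: in addition, the root has weight `-1` (so that every
vertex of weight `1` has a parent). -/
def WTree.IsBipartite (t : WTree) : Prop :=
  t.weight = -1 ∧ t.BipartiteBranch

/-- The links that are closures of arborescent tangles associated with bipartite trees. -/
def bipartiteArborescentLinks : Set Link :=
  {K | ∃ t : WTree, t.IsBipartite ∧ t.closure.toLink = K}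

/-! ## Binary trees and the links of pairs of binary trees -/

/-- Finite rooted plane binary trees. -/
inductive BTree
  | leaf
  | node (l r : BTree)

namespace BTree

/-- Number of leaves. -/
def numLeaves : BTree → ℕ
  | leaf => 1
  | node l r => l.numLeaves + r.numLeaves

/-- Number of carets (trivalent vertices). -/
def carets : BTree → ℕ
  | leaf => 0
  | node l r => l.carets + r.carets + 1

/-- The binary tree with `k` carets, all of them along the right edge; it has `k + 1` leaves. -/
def comb : ℕ → BTree
  | 0 => leaf
  | k + 1 => node leaf (comb k)

theorem numLeaves_eq (T : BTree) : T.numLeaves = T.carets + 1 := by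
  induction T with
  | leaf => rfl
  | node l r hl hr => simp only [numLeaves, carets]; omega

/-- The tree in the upper half plane, with its root edge leaving at the top, after a new strand has
been added from each trivalent vertex down to the horizontal axis, between the two branches at that
vertex.  The resulting `4`-valent vertex is a crossing, in which the strand joining the two branches
passes over the strand formed by the new strand and the edge towards the root. -/
def strands : BTree → Word
  | leaf => []
  | node l r => l.strands ++ r.strands.shift 2 ++ [⟨0, .pos⟩, ⟨1, .cap⟩]

/-- The tangle in the upper half plane: the strand sprouting from the root is extended to the
leftmost point of the horizontal axis. -/
def upper (T : BTree) : Word := T.strands.shift 1 ++ [⟨0, .cap⟩]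

theorem isTangle_strands (T : BTree) : IsTangle (2 * T.carets + 1) T.strands 1 := by
  induction T with
  | leaf => rfl
  | node l r hl hr =>
    have h1 := hl.add_right (2 * r.carets + 2)
    have h2 := hr.shift 2
    have h3 : IsTangle 3 [(⟨0, .pos⟩ : Slice), ⟨1, .cap⟩] 1 := ⟨1, rfl, 0, rfl, rfl⟩
    have e1 : 2 * l.carets + 1 + (2 * r.carets + 2) = 2 * (l.node r).carets + 1 := by
      simp only [carets]; omega
    have e2 : 1 + (2 * r.carets + 2) = 2 * r.carets + 1 + 2 := by omega
    rw [e1, e2] at h1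
    exact (h1.append h2).append h3

theorem isTangle_upper (T : BTree) : IsTangle (2 * T.numLeaves) T.upper 0 := by
  have h := T.isTangle_strands.shift 1
  have e : 2 * T.carets + 1 + 1 = 2 * T.numLeaves := by rw [numLeaves_eq]; omega
  rw [e] at h
  exact h.append ⟨0, rfl, rfl⟩

/-- The leaves of a binary tree as intervals of a dyadic subdivision of `[a, b]`, given by their end
points, from left to right: a trivalent vertex halves its interval. -/
noncomputable def intervals : BTree → ℝ → ℝ → List (ℝ × ℝ)
  | leaf, a, b => [(a, b)]
  | node l r, a, b => l.intervals a ((a + b) / 2) ++ r.intervals ((a + b) / 2) b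

end BTree

/-- The link diagram of a pair of trees `T₊`, `T₋` with equal numbers of leaves: the tangle of `T₊`
in the upper half plane is glued to the tangle of `T₋`, drawn in the same way in the lower half
plane. -/
def thompsonDiagram (Tp Tm : BTree) (h : Tp.numLeaves = Tm.numLeaves) : LinkDiagram :=
  ⟨Tm.upper.vflip ++ Tp.upper, Tm.isTangle_upper.vflip.append (h ▸ Tp.isTangle_upper)⟩

/-! ## The Thompson group and its positive monoid -/

/-- Dyadic rational numbers. -/
def IsDyadic (x : ℝ) : Prop := ∃ (a : ℤ) (n : ℕ), x = a / 2 ^ n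

namespace IsDyadic

theorem zero : IsDyadic 0 := ⟨0, 0, by simp⟩

theorem add {x y : ℝ} (hx : IsDyadic x) (hy : IsDyadic y) : IsDyadic (x + y) := by
  obtain ⟨a, m, rfl⟩ := hx
  obtain ⟨b, n, rfl⟩ := hy
  refine ⟨a * 2 ^ n + b * 2 ^ m, m + n, ?_⟩
  push_cast
  field_simp
  ring

theorem neg {x : ℝ} (hx : IsDyadic x) : IsDyadic (-x) := by
  obtain ⟨a, m, rfl⟩ := hx
  exact ⟨-a, m, by push_cast; ring⟩

theorem sub {x y : ℝ} (hx : IsDyadic x) (hy : IsDyadic y) : IsDyadic (x - y) := by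
  rw [sub_eq_add_neg]
  exact hx.add hy.neg

theorem zpow_mul {x : ℝ} (k : ℤ) (hx : IsDyadic x) : IsDyadic ((2 : ℝ) ^ k * x) := by
  obtain ⟨a, m, rfl⟩ := hx
  obtain ⟨n, rfl | rfl⟩ := k.eq_nat_or_neg
  · exact ⟨2 ^ n * a, m, by push_cast; rw [zpow_natCast]; ring⟩
  · exact ⟨a, m + n, by rw [zpow_neg, zpow_natCast, pow_add]; field_simp⟩

end IsDyadic

/-- `g` is piecewise affine with slopes powers of two and breakpoints in the finite set `B`: on each
subinterval `[x, y]` whose interior contains no point of `B`, it is affine with slope `2 ^ k` for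
some integer `k`. -/
def PiecewiseAffine (g : unitInterval ≃o unitInterval) (B : Finset ℝ) : Prop :=
  ∀ x y : unitInterval, (∀ b ∈ B, ¬ ((x : ℝ) < b ∧ b < y)) →
    ∃ k : ℤ, ∀ u : unitInterval, x ≤ u → u ≤ y → (g u : ℝ) = g x + (2 : ℝ) ^ k * (u - x)

theorem PiecewiseAffine.isDyadic_iff {g : unitInterval ≃o unitInterval} {B : Finset ℝ}
    (hB : ∀ b ∈ B, IsDyadic b) (hg : PiecewiseAffine g B) (x : unitInterval) :
    IsDyadic (g x : ℝ) ↔ IsDyadic (x : ℝ) := by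
  have g0 : g ⊥ = ⊥ := g.map_bot
  have key : ∀ n : ℕ, ∀ x : unitInterval, (B.filter fun b => 0 < b ∧ b < (x : ℝ)).card = n →
      (IsDyadic (g x : ℝ) ↔ IsDyadic (x : ℝ)) := by
    intro n
    induction n using Nat.strong_induction_on with
    | _ n ih =>
      intro x hx
      have step : ∀ z : unitInterval, z ≤ x → IsDyadic (z : ℝ) → IsDyadic (g z : ℝ) →
          (∀ b ∈ B, ¬ ((z : ℝ) < b ∧ b < x)) →
          (IsDyadic (g x : ℝ) ↔ IsDyadic (x : ℝ)) := by
        intro z hzx hz hgz hno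
        obtain ⟨k, hk⟩ := hg z x hno
        have hgx := hk x hzx le_rfl
        constructor
        · intro h
          have e : (x : ℝ) = z + (2 : ℝ) ^ (-k) * ((g x : ℝ) - g z) := by
            rw [hgx, zpow_neg]
            have : (2 : ℝ) ^ k ≠ 0 := by positivity
            field_simp
            ring
          rw [e]
          exact hz.add ((h.sub hgz).zpow_mul _)
        · intro h
          rw [hgx]
          exact hgz.add ((h.sub hz).zpow_mul _)
      by_cases hne : (B.filter fun b => 0 < b ∧ b < (x : ℝ)).Nonempty
      · set c := (B.filter fun b => 0 < b ∧ b < (x : ℝ)).max' hne with hc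
        have hcm := Finset.max'_mem _ hne
        rw [← hc, Finset.mem_filter] at hcm
        obtain ⟨hcB, hc0, hcx⟩ := hcm
        let z : unitInterval := ⟨c, hc0.le, hcx.le.trans x.2.2⟩
        have hz : IsDyadic (z : ℝ) := hB c hcB
        have hlt : (B.filter fun b => 0 < b ∧ b < (z : ℝ)).card < n := by
          rw [← hx]
          apply Finset.card_lt_card
          refine Finset.ssubset_iff_of_subset ?_ |>.2 ⟨c, ?_, ?_⟩
          · intro b hb
            rw [Finset.mem_filter] at hb ⊢
            exact ⟨hb.1, hb.2.1, hb.2.2.trans hcx⟩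
          · exact Finset.mem_filter.2 ⟨hcB, hc0, hcx⟩
          · intro h
            exact lt_irrefl c (Finset.mem_filter.1 h).2.2
        refine step z hcx.le hz ((ih _ hlt z rfl).2 hz) ?_
        rintro b hb ⟨h1, h2⟩
        have : b ≤ c := Finset.le_max' _ _ (Finset.mem_filter.2 ⟨hb, hc0.trans h1, h2⟩)
        exact absurd h1 (not_lt.2 this)
      · refine step ⊥ bot_le IsDyadic.zero (by rw [g0]; exact IsDyadic.zero) ?_
        rintro b hb ⟨h1, h2⟩
        exact hne ⟨b, Finset.mem_filter.2 ⟨hb, h1, h2⟩⟩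
  exact key _ x rfl

/-- The Thompson group `F`: all piecewise affine (increasing) homeomorphisms of the unit interval
with slopes powers of two and dyadic breakpoints.  The product is composition of functions. -/
noncomputable def thompsonF : Subgroup (unitInterval ≃o unitInterval) where
  carrier := {g | ∃ B : Finset ℝ, (∀ b ∈ B, IsDyadic b) ∧ PiecewiseAffine g B}
  one_mem' := ⟨∅, by simp, fun x y _ => ⟨0, fun u _ _ => by simp⟩⟩
  mul_mem' := by
    classical
    rintro g f ⟨B, hB, hg⟩ ⟨C, hC, hf⟩
    refine ⟨C ∪ (B.image fun b =>
      if h : b ∈ Set.Icc (0 : ℝ) 1 then ((f.symm ⟨b, h⟩ : unitInterval) : ℝ) else 0), ?_, ?_⟩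
    · intro b hb
      rcases Finset.mem_union.1 hb with hb | hb
      · exact hC b hb
      · obtain ⟨b', hb', rfl⟩ := Finset.mem_image.1 hb
        split_ifs with h
        · rw [← hf.isDyadic_iff hC, OrderIso.apply_symm_apply]
          exact hB _ hb'
        · exact IsDyadic.zero
    · intro x y hxy
      obtain ⟨k, hk⟩ := hf x y fun b hb => hxy b (Finset.mem_union_left _ hb)
      obtain ⟨l, hl⟩ := hg (f x) (f y) (by
        rintro b hb ⟨h1, h2⟩
        have h : b ∈ Set.Icc (0 : ℝ) 1 := ⟨(f x).2.1.trans h1.le, h2.le.trans (f y).2.2⟩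
        refine hxy ((f.symm ⟨b, h⟩ : unitInterval) : ℝ) (Finset.mem_union_right _
          (Finset.mem_image.2 ⟨b, hb, by simp only [dif_pos h]⟩)) ⟨?_, ?_⟩
        · have : x < f.symm ⟨b, h⟩ := by
            rw [← f.lt_iff_lt, OrderIso.apply_symm_apply]
            exact h1
          exact this
        · have : f.symm ⟨b, h⟩ < y := by
            rw [← f.lt_iff_lt, OrderIso.apply_symm_apply]
            exact h2
          exact this)
      refine ⟨l + k, fun u h1 h2 => ?_⟩
      have e1 := hl (f u) (f.monotone h1) (f.monotone h2)
      have e2 := hk u h1 h2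
      change (g (f u) : ℝ) = g (f x) + _
      rw [e1, e2, zpow_add₀ two_ne_zero]
      ring
  inv_mem' := by
    classical
    rintro g ⟨B, hB, hg⟩
    refine ⟨B.image fun b =>
      if h : b ∈ Set.Icc (0 : ℝ) 1 then ((g ⟨b, h⟩ : unitInterval) : ℝ) else 0, ?_, ?_⟩
    · intro b hb
      obtain ⟨b', hb', rfl⟩ := Finset.mem_image.1 hb
      split_ifs with h
      · exact (hg.isDyadic_iff hB _).2 (hB _ hb')
      · exact IsDyadic.zero
    · intro x y hxy
      obtain ⟨k, hk⟩ := hg (g.symm x) (g.symm y) (by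
        rintro b hb ⟨h1, h2⟩
        have h : b ∈ Set.Icc (0 : ℝ) 1 :=
          ⟨(g.symm x).2.1.trans h1.le, h2.le.trans (g.symm y).2.2⟩
        refine hxy ((g ⟨b, h⟩ : unitInterval) : ℝ)
          (Finset.mem_image.2 ⟨b, hb, by simp only [dif_pos h]⟩) ⟨?_, ?_⟩
        · have : x < g ⟨b, h⟩ := by
            rw [← g.symm.lt_iff_lt, OrderIso.symm_apply_apply]
            exact h1
          exact this
        · have : g ⟨b, h⟩ < y := by
            rw [← g.symm.lt_iff_lt, OrderIso.symm_apply_apply]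
            exact h2
          exact this)
      refine ⟨-k, fun u h1 h2 => ?_⟩
      have e := hk (g.symm u) (g.symm.monotone h1) (g.symm.monotone h2)
      rw [OrderIso.apply_symm_apply, OrderIso.apply_symm_apply] at e
      change (g.symm u : ℝ) = g.symm x + _
      rw [e, zpow_neg]
      have : (2 : ℝ) ^ k ≠ 0 := by positivity
      field_simp
      ring

/-- The homeomorphism of `[0, 1]` (for `0 < d ≤ 1`) that is the identity on `[0, 1 - d]` and maps
`[1 - d, 1 - d/2]`, `[1 - d/2, 1 - d/4]`, `[1 - d/4, 1]` affinely onto `[1 - d, 1 - 3d/4]`,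
`[1 - 3d/4, 1 - d/2]`, `[1 - d/2, 1]`, as a function on real numbers. -/
noncomputable def genFun (d t : ℝ) : ℝ :=
  if t ≤ 1 - d then t
  else if t ≤ 1 - d / 2 then (1 - d) + (t - (1 - d)) / 2
  else if t ≤ 1 - d / 4 then t - d / 4
  else 2 * t - 1

/-- The inverse function of `genFun d`. -/
noncomputable def genInv (d t : ℝ) : ℝ :=
  if t ≤ 1 - d then t
  else if t ≤ 1 - 3 * d / 4 then (1 - d) + 2 * (t - (1 - d))
  else if t ≤ 1 - d / 2 then t + d / 4
  else (t + 1) / 2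

theorem genFun_mem {d t : ℝ} (h0 : 0 < d) (h1 : d ≤ 1) (ht : t ∈ Set.Icc (0 : ℝ) 1) :
    genFun d t ∈ Set.Icc (0 : ℝ) 1 := by
  obtain ⟨h2, h3⟩ := ht
  unfold genFun
  constructor <;> split_ifs <;> linarith

theorem genInv_mem {d t : ℝ} (h0 : 0 < d) (h1 : d ≤ 1) (ht : t ∈ Set.Icc (0 : ℝ) 1) :
    genInv d t ∈ Set.Icc (0 : ℝ) 1 := by
  obtain ⟨h2, h3⟩ := ht
  unfold genInv
  constructor <;> split_ifs <;> linarith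

theorem genInv_genFun {d t : ℝ} (h0 : 0 < d) : genInv d (genFun d t) = t := by
  unfold genFun genInv
  split_ifs <;> linarith

theorem genFun_genInv {d t : ℝ} (h0 : 0 < d) : genFun d (genInv d t) = t := by
  unfold genFun genInv
  split_ifs <;> linarith

theorem genFun_strictMono {d : ℝ} (h0 : 0 < d) : StrictMono (genFun d) := by
  intro s t hst
  unfold genFun
  split_ifs <;> linarith

theorem half_pow_pos_le (n : ℕ) : 0 < (1 / 2 : ℝ) ^ n ∧ (1 / 2 : ℝ) ^ n ≤ 1 :=
  ⟨by positivity, pow_le_one₀ (by norm_num) (by norm_num)⟩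

/-- The standard generator `x_n`, as a homeomorphism of the unit interval. -/
noncomputable def genIso (n : ℕ) : unitInterval ≃o unitInterval where
  toFun t := ⟨genFun ((1 / 2) ^ n) t, genFun_mem (half_pow_pos_le n).1 (half_pow_pos_le n).2 t.2⟩
  invFun t := ⟨genInv ((1 / 2) ^ n) t, genInv_mem (half_pow_pos_le n).1 (half_pow_pos_le n).2 t.2⟩
  left_inv _ := Subtype.ext (genInv_genFun (half_pow_pos_le n).1)
  right_inv _ := Subtype.ext (genFun_genInv (half_pow_pos_le n).1)
  map_rel_iff' := (genFun_strictMono (half_pow_pos_le n).1).le_iff_le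

theorem isDyadic_one_sub (n : ℕ) : IsDyadic (1 - (1 / 2 : ℝ) ^ n) :=
  ⟨2 ^ n - 1, n, by push_cast; rw [sub_div, div_self (by positivity), one_div_pow]⟩

theorem genIso_mem (n : ℕ) : genIso n ∈ thompsonF := by
  classical
  refine ⟨{1 - (1 / 2 : ℝ) ^ n, 1 - (1 / 2 : ℝ) ^ (n + 1), 1 - (1 / 2 : ℝ) ^ (n + 2)}, ?_, ?_⟩
  · intro b hb
    simp only [Finset.mem_insert, Finset.mem_singleton] at hb
    rcases hb with rfl | rfl | rfl <;> exact isDyadic_one_sub _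
  · intro x y hxy
    simp only [Finset.mem_insert, Finset.mem_singleton, forall_eq_or_imp, forall_eq, not_and,
      not_lt] at hxy
    have hd := (half_pow_pos_le n).1
    have e1 : (1 / 2 : ℝ) ^ (n + 1) = (1 / 2) ^ n / 2 := by ring
    have e2 : (1 / 2 : ℝ) ^ (n + 2) = (1 / 2) ^ n / 4 := by ring
    rw [e1, e2] at hxy
    have hval : ∀ u : unitInterval, (genIso n u : ℝ) = genFun ((1 / 2) ^ n) u := fun _ => rfl
    simp only [hval]
    generalize (1 / 2 : ℝ) ^ n = d at *
    obtain ⟨h1, h2, h3⟩ := hxy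
    rcases lt_or_ge (x : ℝ) (1 - d) with a1 | a1
    · refine ⟨0, fun u hu hv => ?_⟩
      have hu' : (x : ℝ) ≤ u := hu
      have hv' : (u : ℝ) ≤ y := hv
      have := h1 a1
      rw [zpow_zero]
      unfold genFun
      split_ifs <;> linarith
    rcases lt_or_ge (x : ℝ) (1 - d / 2) with a2 | a2
    · refine ⟨-1, fun u hu hv => ?_⟩
      have hu' : (x : ℝ) ≤ u := hu
      have hv' : (u : ℝ) ≤ y := hv
      have := h2 a2
      rw [zpow_neg_one]
      unfold genFun
      split_ifs <;> linarith
    rcases lt_or_ge (x : ℝ) (1 - d / 4) with a3 | a3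
    · refine ⟨0, fun u hu hv => ?_⟩
      have hu' : (x : ℝ) ≤ u := hu
      have hv' : (u : ℝ) ≤ y := hv
      have := h3 a3
      rw [zpow_zero]
      unfold genFun
      split_ifs <;> linarith
    · refine ⟨1, fun u hu hv => ?_⟩
      have hu' : (x : ℝ) ≤ u := hu
      have hv' : (u : ℝ) ≤ y := hv
      rw [zpow_one]
      unfold genFun
      split_ifs <;> linarith

/-- The standard generators `x_0, x_1, x_2, …` of the Thompson group. -/
noncomputable def thompsonGen (n : ℕ) : thompsonF := ⟨genIso n, genIso_mem n⟩

/-- The positive monoid `F₊`, generated by `x_0, x_1, x_2, …`. -/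
noncomputable def positiveMonoid : Submonoid thompsonF := Submonoid.closure (Set.range thompsonGen)

/-- The pair `T₊ / T₋` represents `g`: the numbers of leaves agree, and `g` maps the `i`-th interval
of the subdivision given by `T₋` affinely onto the `i`-th interval of the subdivision given by
`T₊`. -/
def Represents (Tp Tm : BTree) (g : thompsonF) : Prop :=
  Tp.numLeaves = Tm.numLeaves ∧
    ∀ p ∈ (Tm.intervals 0 1).zip (Tp.intervals 0 1),
      ∀ x : unitInterval, p.1.1 ≤ x → (x : ℝ) ≤ p.1.2 →
        ((g : unitInterval ≃o unitInterval) x : ℝ) =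
          p.2.1 + (p.2.2 - p.2.1) / (p.1.2 - p.1.1) * (x - p.1.1)

/-- The positive Thompson links: for a positive element `g`, the bottom tree of a pair of trees
representing `g` is chosen to have all its carets along the right edge, and the link associated with
`g` is the link of this pair of trees. -/
def positiveThompsonLinks : Set Link :=
  {K | ∃ g ∈ positiveMonoid, ∃ (Tp : BTree) (k : ℕ) (h : Represents Tp (BTree.comb k) g),
    (thompsonDiagram Tp (BTree.comb k) h.1).toLink = K}

/-! The link of a tree `T` over a comb is cut at the last leaf of `T` and at the leftmost point of
the axis.  This gives a four-ended tangle `X` (`BTree.opened`).  At a caret with branches `l` and `r`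
the strand leaving the last leaf of `l` passes under the two strands that join the branches, whence
`X (node l r) = pos * (X l + neg) + X r`, where `+` is composition side by side and `*` composition
on top of each other (`BTree.eqv_opened`).  A bipartite tree satisfies the same recursion with the
negative crossing on the other side: its tangle is `neg + Y` with `Y = ∑ pos * (neg + Yᵢ)`.  Rotating
by `π` about a vertical axis in the plane of projection exchanges the two recursions and reverses the
order of the summands.  The rotation is an isotopy of a diagram with one lower and one upper end,
since such a rotation is conjugation by half twists, and the half twist of a single strand is trivial
(`Eqv.halfTwist_rotate`, `Eqv.rotate_one`).  So up to isotopy `Y` runs over the rotated tangles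
`BTree.summands`, and the bijection between binary trees and plane trees is `BTree.branches`.

The two kinds of links still join the ends of `Y` differently: the link of `T` joins the left ends
and the right ends of `Y`, whereas a bipartite closure joins the upper ends and the lower ends of
`neg + Y`.  A branch with two vertices is a pair of vertical strands.  As first branch at the root it
absorbs the crossing of the root and turns the second closure into the first
(`BTree.eqv_closure_cons_branches`).  Conversely, the closure of `neg + Y` is the link of a tree with
two more carets, whose crossings cancel against the way in which the ends are joined
(`BTree.eqv_closure_bipartite`).

Every tree over a comb occurs, because each tree arises from a comb by rotations at the end of a right
edge, and these are the actions of the generators `x_n` (`BTree.exists_mem_positiveMonoid`). -/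

/-! ### Typed equivalence of diagrams -/

theorem isTangle_cons {m n : ℕ} {s : Slice} {w : Word} :
    IsTangle m (s :: w) n ↔
      s.left + s.piece.ins ≤ m ∧ IsTangle (m - s.piece.ins + s.piece.outs) w n := by
  constructor
  · rintro ⟨k, hk, h⟩
    refine ⟨by omega, ?_⟩
    have e : m - s.piece.ins + s.piece.outs = s.left + s.piece.outs + k := by omega
    rwa [e]
  · rintro ⟨h, h'⟩
    refine ⟨m - s.left - s.piece.ins, by omega, ?_⟩
    have e : m - s.piece.ins + s.piece.outs =
        s.left + s.piece.outs + (m - s.left - s.piece.ins) := by omega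
    rwa [← e]

theorem isTangle_nil {m n : ℕ} : IsTangle m [] n ↔ m = n := Iff.rfl

theorem Move.isTangle {l r : Word} (h : Move l r) {m n : ℕ} (hl : IsTangle m l n) :
    IsTangle m r n := by
  cases h <;>
    simp only [isTangle_cons, isTangle_nil, Piece.ins, Piece.outs] at hl ⊢ <;> omega

/-- `Eqv m w v`: the words `w` and `v`, placed above `m` strands, are related by local moves.  Every
move has to fit under the given number of strands, so that it remains valid after `w` and `v` are
completed to a link diagram. -/
inductive Eqv : ℕ → Word → Word → Prop
  | refl (m : ℕ) (w : Word) : Eqv m w w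
  | symm {m : ℕ} {w v : Word} : Eqv m w v → Eqv m v w
  | trans {m : ℕ} {w v u : Word} : Eqv m w v → Eqv m v u → Eqv m w u
  | move {l r : Word} (h : Move l r) {m n : ℕ} (hl : IsTangle m l n) (u : Word) :
      Eqv m (l ++ u) (r ++ u)
  | cons {m k : ℕ} {s : Slice} {w v : Word} (hk : m = s.left + s.piece.ins + k) :
      Eqv (s.left + s.piece.outs + k) w v → Eqv m (s :: w) (s :: v)

namespace Eqv

instance (m : ℕ) : Trans (Eqv m) (Eqv m) (Eqv m) := ⟨Eqv.trans⟩

theorem of_eq {m : ℕ} {w v : Word} (h : w = v) : Eqv m w v := h ▸ .refl m w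

/-- Equivalent words have the same number of upper ends. -/
theorem isTangle_iff {m n : ℕ} {w v : Word} (h : Eqv m w v) :
    IsTangle m w n ↔ IsTangle m v n := by
  induction h generalizing n with
  | refl => rfl
  | symm _ ih => exact ih.symm
  | trans _ _ ih₁ ih₂ => exact ih₁.trans ih₂
  | @move l r h m k hl u =>
    have key : ∀ {l : Word}, IsTangle m l k → (IsTangle m (l ++ u) n ↔ IsTangle k u n) := by
      clear h hl
      intro l hl
      induction l generalizing m with
      | nil => cases hl; rfl
      | cons s l ih =>
        obtain ⟨j, hj, hl⟩ := hl
        subst hj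
        constructor
        · rintro ⟨i, hi, h⟩
          obtain rfl : i = j := by omega
          exact (ih hl).1 h
        · intro h
          exact ⟨j, rfl, (ih hl).2 h⟩
    rw [key hl, key (h.isTangle hl)]
  | @cons m k s w v hk _ ih =>
    subst hk
    constructor <;>
    · rintro ⟨j, hj, h⟩
      obtain rfl : k = j := by omega
      exact ⟨k, rfl, by first | exact ih.1 h | exact ih.2 h⟩

theorem toLink_append_eq {m : ℕ} {w v : Word} (h : Eqv m w v) (a : Word)
    (hw : IsTangle 0 (a ++ w) 0) (hv : IsTangle 0 (a ++ v) 0) (ha : IsTangle 0 a m) :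
    LinkDiagram.toLink ⟨a ++ w, hw⟩ = LinkDiagram.toLink ⟨a ++ v, hv⟩ := by
  induction h generalizing a with
  | refl => rfl
  | symm _ ih => exact (ih a hv hw ha).symm
  | @trans m w x v h₁ h₂ ih₁ ih₂ =>
    have hx : IsTangle 0 (a ++ x) 0 := by
      have key : ∀ {a : Word} {k : ℕ}, IsTangle k a m → IsTangle k (a ++ w) 0 →
          IsTangle m w 0 := by
        clear * -
        intro a
        induction a with
        | nil => intro k h h'; cases h; exact h'
        | cons s a ih =>
          rintro k ⟨i, hi, h⟩ ⟨j, hj, h'⟩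
          obtain rfl : i = j := by omega
          exact ih h h'
      exact ha.append (h₁.isTangle_iff.1 (key ha hw))
    exact (ih₁ a hw hx ha).trans (ih₂ a hx hv ha)
  | @move l r h m k hl u =>
    exact Quot.sound ⟨a, u, l, r, h, (List.append_assoc ..).symm, (List.append_assoc ..).symm⟩
  | @cons m k s w v hk _ ih =>
    have e : ∀ x, a ++ s :: x = (a ++ [s]) ++ x := fun x => by simp
    have := ih (a ++ [s]) (e w ▸ hw) (e v ▸ hv) (ha.append ⟨k, hk, rfl⟩)
    simpa only [← e] using this

/-- Equivalent words without ends are diagrams of the same link. -/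
theorem toLink_eq {w v : Word} (h : Eqv 0 w v) (hw : IsTangle 0 w 0) (hv : IsTangle 0 v 0) :
    LinkDiagram.toLink ⟨w, hw⟩ = LinkDiagram.toLink ⟨v, hv⟩ :=
  h.toLink_append_eq [] hw hv rfl

theorem cons' {m i : ℕ} {p : Piece} {w v : Word} (h : Eqv (m - p.ins + p.outs) w v)
    (hs : i + p.ins ≤ m := by first | omega | (simp only [Piece.ins, Piece.outs] <;> omega)) :
    Eqv m (⟨i, p⟩ :: w) (⟨i, p⟩ :: v) := by
  refine .cons (k := m - i - p.ins) (by simp only; omega) ?_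
  have e : m - p.ins + p.outs = i + p.outs + (m - i - p.ins) := by omega
  rwa [← e]

theorem append_right {m : ℕ} {w v : Word} (h : Eqv m w v) (u : Word) :
    Eqv m (w ++ u) (v ++ u) := by
  induction h with
  | refl => exact .refl _ _
  | symm _ ih => exact ih.symm
  | trans _ _ ih₁ ih₂ => exact ih₁.trans ih₂
  | @move l r h m k hl x =>
    rw [List.append_assoc, List.append_assoc]
    exact .move h hl _
  | cons hk _ ih => exact .cons hk ih

theorem append_left {m n : ℕ} {a w v : Word} (ha : IsTangle m a n) (h : Eqv n w v) :
    Eqv m (a ++ w) (a ++ v) := by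
  induction a generalizing m with
  | nil => cases ha; exact h
  | cons s a ih =>
    obtain ⟨k, hk, ha⟩ := ha
    exact .cons hk (ih ha)

theorem add_right {m : ℕ} {w v : Word} (r : ℕ) (h : Eqv m w v) : Eqv (m + r) w v := by
  induction h with
  | refl => exact .refl _ _
  | symm _ ih => exact ih.symm
  | trans _ _ ih₁ ih₂ => exact ih₁.trans ih₂
  | move h hl x => exact .move h (hl.add_right r) _
  | @cons m k s w v hk _ ih =>
    exact .cons (k := k + r) (by omega) (by rwa [← add_assoc])

/-- Equivalence persists under additional strands to the right. -/
theorem mono {m n : ℕ} {w v : Word} (h : Eqv m w v)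
    (hmn : m ≤ n := by first | omega | (simp only [Piece.ins, Piece.outs] <;> omega)) :
    Eqv n w v := by
  obtain ⟨r, rfl⟩ := Nat.exists_eq_add_of_le hmn
  exact h.add_right r

end Eqv

namespace Word

@[simp] theorem shift_nil (k : ℕ) : Word.shift k [] = [] := rfl

@[simp] theorem shift_cons (k : ℕ) (s : Slice) (w : Word) :
    Word.shift k (s :: w) = ⟨s.left + k, s.piece⟩ :: Word.shift k w := rfl

@[simp] theorem shift_append (k : ℕ) (w v : Word) :
    Word.shift k (w ++ v) = Word.shift k w ++ Word.shift k v := List.map_append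

@[simp] theorem shift_shift (k l : ℕ) (w : Word) :
    Word.shift k (Word.shift l w) = Word.shift (l + k) w := by
  simp [Word.shift, Function.comp_def, add_assoc]

@[simp] theorem shift_zero (w : Word) : Word.shift 0 w = w := by
  simp [Word.shift]

end Word

theorem Move.shift {l r : Word} (h : Move l r) (k : ℕ) :
    Move (Word.shift k l) (Word.shift k r) := by
  cases h with
  | exchange i j p q =>
    have := Move.exchange (i + k) j p q
    have e₁ : i + k + p.outs + j = i + p.outs + j + k := by omega
    have e₂ : i + k + p.ins + j = i + p.ins + j + k := by omega
    rwa [e₁, e₂] at this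
  | _ i =>
    have e : i + k + 1 = i + 1 + k := by omega
    simp only [Word.shift_cons, Word.shift_nil, ← e]
    constructor

theorem Eqv.shift {m : ℕ} {w v : Word} (r : ℕ) (h : Eqv m w v) :
    Eqv (m + r) (Word.shift r w) (Word.shift r v) := by
  induction h with
  | refl => exact .refl _ _
  | symm _ ih => exact ih.symm
  | trans _ _ ih₁ ih₂ => exact ih₁.trans ih₂
  | move h hl x =>
    rw [Word.shift_append, Word.shift_append]
    exact .move (h.shift r) (hl.shift r) _
  | @cons m k s w v hk _ ih =>
    refine .cons (k := k) (by simp only; omega) ?_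
    have e : s.left + s.piece.outs + k + r = s.left + r + s.piece.outs + k := by omega
    exact e ▸ ih

/-- Two tangles side by side exchange their heights. -/
theorem Eqv.interchange {m a b c d : ℕ} {w v : Word} (hw : IsTangle a w b) (hv : IsTangle c v d)
    (h : a + c ≤ m) (u : Word) :
    Eqv m (w ++ (Word.shift b v ++ u)) (Word.shift a v ++ (w ++ u)) := by
  have slice : ∀ {i k c m : ℕ} (p : Piece) {v : Word} (u : Word), IsTangle c v d →
      i + p.ins + k + c ≤ m →
      Eqv m (⟨i, p⟩ :: (Word.shift (i + p.outs + k) v ++ u))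
        (Word.shift (i + p.ins + k) v ++ ⟨i, p⟩ :: u) := by
    intro i k c m p v u hv h
    induction v generalizing c m with
    | nil => exact .refl _ _
    | cons t v ih =>
      obtain ⟨l, hl, hv⟩ := hv
      have hex : Eqv m (⟨i, p⟩ :: ⟨i + p.outs + (k + t.left), t.piece⟩ ::
            (Word.shift (i + p.outs + k) v ++ u))
          (⟨i + p.ins + (k + t.left), t.piece⟩ :: ⟨i, p⟩ ::
            (Word.shift (i + p.outs + k) v ++ u)) := by
        refine Eqv.move (Move.exchange i (k + t.left) p t.piece)
          (n := m - p.ins + p.outs - t.piece.ins + t.piece.outs) ?_ _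
        simp only [isTangle_cons, isTangle_nil, and_true]
        omega
      have e₁ : i + p.outs + (k + t.left) = t.left + (i + p.outs + k) := by omega
      have e₂ : i + p.ins + (k + t.left) = t.left + (i + p.ins + k) := by omega
      rw [e₁, e₂] at hex
      refine hex.trans (.cons' (ih hv (by omega)))
  induction w generalizing a m with
  | nil => cases hw; exact .refl _ _
  | cons s w ih =>
    obtain ⟨k, rfl, hw⟩ := hw
    refine .trans (.cons' (ih hw (by omega))) ?_
    exact slice s.piece (w ++ u) hv h

/-! ### The half twist -/

/-- The word in which the leftmost strand passes over `n` strands to its right. -/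
def overstrand : ℕ → Word
  | 0 => []
  | n + 1 => overstrand n ++ [⟨n, .pos⟩]

theorem isTangle_overstrand (n : ℕ) : IsTangle (n + 1) (overstrand n) (n + 1) := by
  induction n with
  | zero => rfl
  | succ n ih => exact (ih.add_right 1).append ⟨0, rfl, rfl⟩

theorem overstrand_add (m n : ℕ) :
    overstrand (m + n) = overstrand m ++ Word.shift m (overstrand n) := by
  induction n with
  | zero => simp [overstrand]
  | succ n ih => simp [overstrand, ih, add_comm]

/-- The positive half twist of `n` strands. -/
def halfTwist : ℕ → Word
  | 0 => []
  | n + 1 => overstrand n ++ halfTwist n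

theorem isTangle_halfTwist (n : ℕ) : IsTangle n (halfTwist n) n := by
  induction n with
  | zero => rfl
  | succ n ih => exact (isTangle_overstrand n).append (ih.add_right 1)

/-- The image of a diagram above `m` strands under the rotation by the angle `π` about a vertical
axis in the plane of projection; this rotation preserves the signs of crossings.
The subtractions are not truncated if the diagram fits above `m` strands. -/
def Word.rotate : ℕ → Word → Word
  | _, [] => []
  | m, s :: w =>
    ⟨m - s.left - s.piece.ins, s.piece⟩ :: Word.rotate (m - s.piece.ins + s.piece.outs) w

/-- The word `w` can be placed above `m` strands. -/
def Word.Fits : ℕ → Word → Prop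
  | _, [] => True
  | m, s :: w => s.left + s.piece.ins ≤ m ∧ Word.Fits (m - s.piece.ins + s.piece.outs) w

theorem Word.Fits.exists_isTangle {m : ℕ} {w : Word} (h : Word.Fits m w) :
    ∃ n, IsTangle m w n := by
  induction w generalizing m with
  | nil => exact ⟨m, rfl⟩
  | cons s w ih =>
    obtain ⟨n, hn⟩ := ih h.2
    exact ⟨n, isTangle_cons.2 ⟨h.1, hn⟩⟩

/-- A local move at the bottom of a word, from left to right. -/
theorem Eqv.fwd {l r : Word} (h : Move l r) {m : ℕ} (u : Word)
    (hl : Word.Fits m l := by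
      simp only [Word.Fits, Piece.ins, Piece.outs, and_true] <;> omega) :
    Eqv m (l ++ u) (r ++ u) :=
  let ⟨_, hn⟩ := hl.exists_isTangle
  .move h hn u

/-- A local move at the bottom of a word, from right to left. -/
theorem Eqv.bwd {l r : Word} (h : Move l r) {m : ℕ} (u : Word)
    (hl : Word.Fits m l := by
      simp only [Word.Fits, Piece.ins, Piece.outs, and_true] <;> omega) :
    Eqv m (r ++ u) (l ++ u) :=
  (Eqv.fwd h u hl).symm

/-- Two crossings or extrema at a distance exchange their heights. -/
theorem Eqv.exchange {m : ℕ} {i j i' : ℕ} {p q : Piece} (u : Word)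
    (hj : i + p.outs ≤ j := by first | omega | (simp only [Piece.ins, Piece.outs] <;> omega))
    (hi : j + p.ins = i' + p.outs := by first | omega | (simp only [Piece.ins, Piece.outs] <;> omega))
    (hm : i' + q.ins ≤ m := by first | omega | (simp only [Piece.ins, Piece.outs] <;> omega)) :
    Eqv m (⟨i, p⟩ :: ⟨j, q⟩ :: u) (⟨i', q⟩ :: ⟨i, p⟩ :: u) := by
  obtain ⟨k, rfl⟩ := Nat.exists_eq_add_of_le hj
  obtain rfl : i' = i + p.ins + k := by omega
  refine Eqv.fwd (Move.exchange i k p q) u ?_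
  simp only [Word.Fits, and_true]
  omega

theorem IsTangle.widen {a b m n : ℕ} {w : Word} (hw : IsTangle a w b) (h : a ≤ m)
    (hn : m + b = n + a) : IsTangle m w n := by
  have := hw.add_right (m - a)
  rwa [show a + (m - a) = m by omega, show b + (m - a) = n by omega] at this

theorem IsTangle.place {a b m n : ℕ} {w : Word} (hw : IsTangle a w b) (k : ℕ) (h : a + k ≤ m)
    (hn : m + b = n + a) : IsTangle m (Word.shift k w) n :=
  (hw.shift k).widen h (by omega)

namespace Eqv

/-- A lower part of a diagram may use fewer strands than there are; the remaining ones are to its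
right. -/
theorem append_widen {m a b : ℕ} {w x y : Word} (hw : IsTangle a w b)
    (hxy : Eqv (m - a + b) x y) (h : a ≤ m := by
      first | omega | (simp only [Piece.ins, Piece.outs] <;> omega)) :
    Eqv m (w ++ x) (w ++ y) :=
  .append_left (hw.widen h (by omega)) hxy

theorem append_place {m a b : ℕ} {w x y : Word} (hw : IsTangle a w b) (k : ℕ)
    (hxy : Eqv (m - a + b) x y) (h : a + k ≤ m := by
      first | omega | (simp only [Piece.ins, Piece.outs] <;> omega)) :
    Eqv m (Word.shift k w ++ x) (Word.shift k w ++ y) :=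
  .append_left (hw.place k h (by omega)) hxy

/-- The third Reidemeister move with one negative crossing, the top strand being the one that starts
on the left. -/
theorem third_neg_left {m i : ℕ} (u : Word) (h : i + 3 ≤ m) :
    Eqv m (⟨i + 1, .neg⟩ :: ⟨i, .pos⟩ :: ⟨i + 1, .pos⟩ :: u)
      (⟨i, .pos⟩ :: ⟨i + 1, .pos⟩ :: ⟨i, .neg⟩ :: u) := by
  calc
    Eqv m (⟨i + 1, .neg⟩ :: ⟨i, .pos⟩ :: ⟨i + 1, .pos⟩ :: u)
      (⟨i + 1, .neg⟩ :: ⟨i, .pos⟩ :: ⟨i + 1, .pos⟩ :: ⟨i, .pos⟩ :: ⟨i, .neg⟩ :: u) := by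
        refine .append_left (a := [_, _, _]) (n := m) ?_ (.bwd (.reidemeister_two_pos_neg i) u)
        simp only [isTangle_cons, isTangle_nil, Piece.ins, Piece.outs]
        omega
    Eqv m _ (⟨i + 1, .neg⟩ :: ⟨i + 1, .pos⟩ :: ⟨i, .pos⟩ :: ⟨i + 1, .pos⟩ :: ⟨i, .neg⟩ :: u) :=
        .cons' (.fwd (.reidemeister_three_pos i) (⟨i, .neg⟩ :: u))
    Eqv m _ _ := .fwd (.reidemeister_two_neg_pos (i + 1)) _

/-- The third Reidemeister move with one negative crossing, the two strands that start on the left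
lying above the third. -/
theorem third_neg_right {m i : ℕ} (u : Word) (h : i + 3 ≤ m) :
    Eqv m (⟨i, .neg⟩ :: ⟨i + 1, .pos⟩ :: ⟨i, .pos⟩ :: u)
      (⟨i + 1, .pos⟩ :: ⟨i, .pos⟩ :: ⟨i + 1, .neg⟩ :: u) := by
  calc
    Eqv m (⟨i, .neg⟩ :: ⟨i + 1, .pos⟩ :: ⟨i, .pos⟩ :: u)
      (⟨i, .neg⟩ :: ⟨i + 1, .pos⟩ :: ⟨i, .pos⟩ :: ⟨i + 1, .pos⟩ :: ⟨i + 1, .neg⟩ :: u) := by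
        refine .append_left (a := [_, _, _]) (n := m) ?_
          (.bwd (.reidemeister_two_pos_neg (i + 1)) u)
        simp only [isTangle_cons, isTangle_nil, Piece.ins, Piece.outs]
        omega
    Eqv m _ (⟨i, .neg⟩ :: ⟨i, .pos⟩ :: ⟨i + 1, .pos⟩ :: ⟨i, .pos⟩ :: ⟨i + 1, .neg⟩ :: u) :=
        .cons' (.bwd (.reidemeister_three_pos i) (⟨i + 1, .neg⟩ :: u))
    Eqv m _ _ := .fwd (.reidemeister_two_neg_pos i) _

/-- A strand that passes over everything else on one side of an elementary piece can be moved to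
the other side; here nothing but the ends of the piece is crossed. -/
theorem overstrand_piece {m i : ℕ} (p : Piece) (u : Word) (h : i + 1 + p.ins ≤ m) :
    Eqv m (⟨i + 1, p⟩ :: (Word.shift i (overstrand p.outs) ++ u))
      (Word.shift i (overstrand p.ins) ++ ⟨i, p⟩ :: u) := by
  cases p <;>
    simp only [Piece.ins, Piece.outs, overstrand, List.nil_append, Word.shift_cons,
      Word.shift_nil, List.cons_append, zero_add, add_comm 1 i] at h ⊢
  · calc
      Eqv m (⟨i + 1, .cup⟩ :: ⟨i, .pos⟩ :: ⟨i + 1, .pos⟩ :: u)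
          (⟨i, .cup⟩ :: ⟨i + 1, .neg⟩ :: ⟨i + 1, .pos⟩ :: u) :=
            .bwd (.slide_cup_neg i) (⟨i + 1, .pos⟩ :: u)
      Eqv m _ (⟨i, .cup⟩ :: u) :=
        .cons' (.fwd (.reidemeister_two_neg_pos (i + 1)) u)
  · calc
      Eqv m (⟨i + 1, .cap⟩ :: u) (⟨i, .pos⟩ :: ⟨i, .neg⟩ :: ⟨i + 1, .cap⟩ :: u) :=
            .bwd (.reidemeister_two_pos_neg i) (⟨i + 1, .cap⟩ :: u)
      Eqv m _ (⟨i, .pos⟩ :: ⟨i + 1, .pos⟩ :: ⟨i, .cap⟩ :: u) :=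
        .cons' (.bwd (.slide_cap_pos i) u)
  · exact .bwd (.reidemeister_three_pos i) u
  · exact third_neg_left u (by omega)

/-- A slice can be moved below a strand that passes over the whole diagram. -/
theorem overstrand_slice {m i : ℕ} (k : ℕ) (p : Piece) (u : Word) (hm : i + p.ins + k + 1 ≤ m) :
    Eqv m (⟨i + 1, p⟩ :: (overstrand (i + p.outs + k) ++ u))
      (overstrand (i + p.ins + k) ++ ⟨i, p⟩ :: u) := by
  have hp : IsTangle p.ins [⟨0, p⟩] p.outs := ⟨0, by simp, by simp; rfl⟩
  have hp' : IsTangle (i + p.ins) [⟨i, p⟩] (i + p.outs) := ⟨0, rfl, rfl⟩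
  simp only [overstrand_add, List.append_assoc]
  have h₁ := (interchange (m := m) (isTangle_overstrand i) hp (by omega)
    (Word.shift i (overstrand p.outs) ++ (Word.shift (i + p.outs) (overstrand k) ++ u))).symm
  simp only [Word.shift_cons, Word.shift_nil, List.cons_append, List.nil_append, zero_add] at h₁
  refine h₁.trans (.append_widen (isTangle_overstrand i) ?_)
  refine (overstrand_piece p _ (by omega)).trans
    (.append_place (isTangle_overstrand p.ins) _ ?_)
  exact interchange hp' (isTangle_overstrand k) (by omega) u

/-- Two parallel strands pass over `k` strands to their right. -/
def _root_.doubleOverstrand (k : ℕ) : Word :=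
  Word.shift 1 (overstrand k) ++ overstrand k

theorem _root_.isTangle_doubleOverstrand (k : ℕ) :
    IsTangle (k + 2) (doubleOverstrand k) (k + 2) :=
  ((isTangle_overstrand k).shift 1).append ((isTangle_overstrand k).add_right 1)

theorem doubleOverstrand_succ {m : ℕ} (k : ℕ) (u : Word) (hm : k + 3 ≤ m) :
    Eqv m (doubleOverstrand (k + 1) ++ u)
      (doubleOverstrand k ++ ⟨k + 1, .pos⟩ :: ⟨k, .pos⟩ :: u) := by
  have hp : IsTangle 2 [⟨0, .pos⟩] 2 := ⟨0, rfl, rfl⟩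
  simp only [doubleOverstrand, overstrand, Word.shift_append, Word.shift_cons, Word.shift_nil,
    List.append_assoc, List.cons_append, List.nil_append]
  refine .append_place (isTangle_overstrand k) 1 ?_
  have := interchange (m := m - (k + 1) + (k + 1)) (isTangle_overstrand k) hp (by omega)
    (⟨k, .pos⟩ :: u)
  simp only [Word.shift_cons, Word.shift_nil, List.cons_append, List.nil_append, zero_add] at this
  exact this.symm

/-- Two parallel strands joined by a minimum are pulled off the strands that they pass over. -/
theorem cup_doubleOverstrand {m : ℕ} (k : ℕ) (u : Word) (hm : k ≤ m) :
    Eqv m (⟨0, .cup⟩ :: (doubleOverstrand k ++ u)) (⟨k, .cup⟩ :: u) := by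
  induction k generalizing u with
  | zero => exact .refl _ _
  | succ k ih =>
    refine (Eqv.cons' (doubleOverstrand_succ k u ?_)).trans ?_
    · simp only [Piece.ins, Piece.outs]; omega
    refine (ih _ (by omega)).trans ?_
    calc
      Eqv m (⟨k, .cup⟩ :: ⟨k + 1, .pos⟩ :: ⟨k, .pos⟩ :: u)
        (⟨k + 1, .cup⟩ :: ⟨k, .neg⟩ :: ⟨k, .pos⟩ :: u) := .fwd (.slide_cup_pos k) (⟨k, .pos⟩ :: u)
      Eqv m _ (⟨k + 1, .cup⟩ :: u) :=
        .cons' (.fwd (.reidemeister_two_neg_pos k) u)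

theorem cap_doubleOverstrand {m : ℕ} (k : ℕ) (u : Word) (hm : k + 2 ≤ m) :
    Eqv m (doubleOverstrand k ++ ⟨k, .cap⟩ :: u) (⟨0, .cap⟩ :: u) := by
  induction k generalizing u with
  | zero => exact .refl _ _
  | succ k ih =>
    refine (doubleOverstrand_succ k _ (by omega)).trans (Eqv.trans ?_ (ih u (by omega)))
    refine .append_widen (isTangle_doubleOverstrand k) ?_
    set n := m - (k + 2) + (k + 2)
    have hn : k + 3 ≤ n := by omega
    calc
      Eqv n (⟨k + 1, .pos⟩ :: ⟨k, .pos⟩ :: ⟨k + 1, .cap⟩ :: u)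
        (⟨k + 1, .pos⟩ :: ⟨k + 1, .neg⟩ :: ⟨k, .cap⟩ :: u) :=
          .cons' (.bwd (.slide_cap_neg k) u)
      Eqv n _ (⟨k, .cap⟩ :: u) := .fwd (.reidemeister_two_pos_neg (k + 1)) (⟨k, .cap⟩ :: u)

theorem crossing_doubleOverstrand {m : ℕ} {p : Piece} (hp : p = .pos ∨ p = .neg) (k : ℕ) (u : Word)
    (hm : k + 2 ≤ m) :
    Eqv m (⟨0, p⟩ :: (doubleOverstrand k ++ u)) (doubleOverstrand k ++ ⟨k, p⟩ :: u) := by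
  induction k generalizing u with
  | zero => exact .refl _ _
  | succ k ih =>
    have hio : p.ins = 2 ∧ p.outs = 2 := by rcases hp with rfl | rfl <;> exact ⟨rfl, rfl⟩
    refine (Eqv.cons' (doubleOverstrand_succ k u ?_)).trans ?_
    · omega
    refine (ih _ (by omega)).trans (Eqv.trans ?_ (doubleOverstrand_succ k _ (by omega)).symm)
    refine .append_widen (isTangle_doubleOverstrand k) ?_
    rcases hp with rfl | rfl
    · exact .fwd (.reidemeister_three_pos k) u
    · exact third_neg_right u (by omega)

theorem _root_.halfTwist_add_two (k : ℕ) :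
    halfTwist (k + 2) = ⟨0, .pos⟩ :: (doubleOverstrand k ++ halfTwist k) := by
  simp only [halfTwist, doubleOverstrand]
  rw [add_comm k 1, overstrand_add 1 k]
  simp [overstrand]

/-- The half twist carries a piece at the left margin to the right margin. -/
theorem piece_halfTwist {m : ℕ} (k : ℕ) (p : Piece) (u : Word) (hm : p.ins + k ≤ m) :
    Eqv m (⟨0, p⟩ :: (halfTwist (p.outs + k) ++ u)) (halfTwist (p.ins + k) ++ ⟨k, p⟩ :: u) := by
  have hq : IsTangle p.ins [⟨0, p⟩] p.outs := ⟨0, by simp, by simp; rfl⟩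
  have hk := isTangle_halfTwist k
  have twist : ∀ {n : ℕ}, k + p.ins ≤ n →
      Eqv n (⟨k, p⟩ :: (halfTwist k ++ u)) (halfTwist k ++ ⟨k, p⟩ :: u) := by
    intro n hn
    have := (interchange (m := n) hk hq (by omega) u).symm
    simpa using this
  have crossing : p = .pos ∨ p = .neg → Eqv m (⟨0, p⟩ :: (halfTwist (k + 2) ++ u))
      (halfTwist (k + 2) ++ ⟨k, p⟩ :: u) := by
    intro hp
    have hio : p.ins = 2 ∧ p.outs = 2 := by rcases hp with rfl | rfl <;> exact ⟨rfl, rfl⟩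
    rw [halfTwist_add_two]
    simp only [List.cons_append, List.append_assoc]
    have h₁ : ∀ v, Eqv m (⟨0, p⟩ :: ⟨0, .pos⟩ :: v) (⟨0, .pos⟩ :: ⟨0, p⟩ :: v) := by
      intro v
      rcases hp with rfl | rfl
      · exact .refl _ _
      · exact (Eqv.fwd (.reidemeister_two_neg_pos 0) v).trans
          (.bwd (.reidemeister_two_pos_neg 0) v)
    refine (h₁ _).trans (.cons' ?_)
    simp only [Piece.ins, Piece.outs]
    refine (crossing_doubleOverstrand hp k _ (by omega)).trans
      (.append_widen (isTangle_doubleOverstrand k) (twist (by omega)))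
  cases p with
  | cup =>
    simp only [Piece.ins, Piece.outs, zero_add, add_comm 2 k] at hm twist ⊢
    rw [halfTwist_add_two]
    calc
      Eqv m (⟨0, .cup⟩ :: (⟨0, .pos⟩ :: (doubleOverstrand k ++ halfTwist k) ++ u))
        (⟨0, .cup⟩ :: (doubleOverstrand k ++ (halfTwist k ++ u))) := by
          rw [← List.append_assoc]
          exact .fwd (.reidemeister_one_cup_pos 0) _
      Eqv m _ (⟨k, .cup⟩ :: (halfTwist k ++ u)) := cup_doubleOverstrand k _ hm
      Eqv m _ _ := twist hm
  | cap =>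
    simp only [Piece.ins, Piece.outs, zero_add, add_comm 2 k] at hm twist ⊢
    rw [halfTwist_add_two]
    simp only [List.cons_append, List.append_assoc]
    refine Eqv.symm ?_
    calc
      Eqv m (⟨0, .pos⟩ :: (doubleOverstrand k ++ (halfTwist k ++ ⟨k, .cap⟩ :: u)))
        (⟨0, .pos⟩ :: (doubleOverstrand k ++ (⟨k, .cap⟩ :: (halfTwist k ++ u)))) := by
          refine .cons' ?_
          simp only [Piece.ins, Piece.outs]
          exact .append_widen (isTangle_doubleOverstrand k) (twist (by omega)).symm
      Eqv m _ (⟨0, .pos⟩ :: ⟨0, .cap⟩ :: (halfTwist k ++ u)) := by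
          refine .cons' (cap_doubleOverstrand k _ ?_)
          simp only [Piece.ins, Piece.outs]
          omega
      Eqv m _ _ := .fwd (.reidemeister_one_cap_pos 0) _
  | pos =>
    simp only [Piece.ins, Piece.outs, add_comm 2 k]
    exact crossing (.inl rfl)
  | neg =>
    simp only [Piece.ins, Piece.outs, add_comm 2 k]
    exact crossing (.inr rfl)

theorem slice_halfTwist {m i : ℕ} (k : ℕ) (p : Piece) (u : Word) (hm : i + p.ins + k ≤ m) :
    Eqv m (⟨i, p⟩ :: (halfTwist (i + p.outs + k) ++ u))
      (halfTwist (i + p.ins + k) ++ ⟨k, p⟩ :: u) := by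
  induction i generalizing m u with
  | zero => simpa using piece_halfTwist k p u (by omega)
  | succ i ih =>
    have e : ∀ j, i + 1 + j + k = i + j + k + 1 := by omega
    simp only [e, halfTwist, List.append_assoc]
    refine (overstrand_slice k p _ (by omega)).trans ?_
    exact .append_widen (isTangle_overstrand _) (ih u (by omega))

/-- Turning the lower ends of a diagram by a half twist is the same as rotating the diagram and
turning its upper ends. -/
theorem halfTwist_rotate {m n : ℕ} {w : Word} (hw : IsTangle m w n) (u : Word) :
    Eqv m (w ++ (halfTwist n ++ u)) (halfTwist m ++ (Word.rotate m w ++ u)) := by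
  induction w generalizing m with
  | nil => cases hw; exact .refl _ _
  | cons s w ih =>
    obtain ⟨k, rfl, hw⟩ := hw
    have e₁ : s.left + s.piece.ins + k - s.left - s.piece.ins = k := by omega
    have e₂ : s.left + s.piece.ins + k - s.piece.ins + s.piece.outs =
      s.left + s.piece.outs + k := by omega
    simp only [Word.rotate, e₁, e₂]
    exact (Eqv.cons rfl (ih hw)).trans (slice_halfTwist k s.piece _ le_rfl)

/-- A diagram with one lower and one upper end is isotopic to its rotated diagram. -/
theorem rotate_one {w : Word} (hw : IsTangle 1 w 1) : Eqv 1 w (Word.rotate 1 w) := by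
  simpa [halfTwist, overstrand] using halfTwist_rotate hw []

end Eqv

namespace Word

theorem rotate_append {m n : ℕ} {w : Word} (hw : IsTangle m w n) (v : Word) :
    Word.rotate m (w ++ v) = Word.rotate m w ++ Word.rotate n v := by
  induction w generalizing m with
  | nil => cases hw; rfl
  | cons s w ih =>
    obtain ⟨k, rfl, hw⟩ := hw
    have e : s.left + s.piece.ins + k - s.piece.ins + s.piece.outs =
      s.left + s.piece.outs + k := by omega
    simp only [List.cons_append, Word.rotate, e, ih hw]

theorem rotate_add {m n : ℕ} {w : Word} (hw : IsTangle m w n) (r : ℕ) :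
    Word.rotate (m + r) w = Word.shift r (Word.rotate m w) := by
  induction w generalizing m with
  | nil => rfl
  | cons s w ih =>
    obtain ⟨k, rfl, hw⟩ := hw
    have e : s.left + s.piece.ins + k - s.piece.ins + s.piece.outs =
      s.left + s.piece.outs + k := by omega
    have e' : s.left + s.piece.ins + k + r - s.piece.ins + s.piece.outs =
      s.left + s.piece.outs + k + r := by omega
    simp only [Word.rotate, e, e', ih hw, shift_cons]
    congr 2
    omega

theorem rotate_shift {m n : ℕ} {w : Word} (hw : IsTangle m w n) (r : ℕ) :
    Word.rotate (m + r) (Word.shift r w) = Word.rotate m w := by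
  induction w generalizing m with
  | nil => rfl
  | cons s w ih =>
    obtain ⟨k, rfl, hw⟩ := hw
    have e : s.left + s.piece.ins + k - s.piece.ins + s.piece.outs =
      s.left + s.piece.outs + k := by omega
    have e' : s.left + s.piece.ins + k + r - s.piece.ins + s.piece.outs =
      s.left + s.piece.outs + k + r := by omega
    simp only [Word.rotate, shift_cons, e, e', ih hw]
    congr 2
    omega

end Word

theorem IsTangle.rotate {m n : ℕ} {w : Word} (hw : IsTangle m w n) :
    IsTangle m (Word.rotate m w) n := by
  induction w generalizing m with
  | nil => exact hw
  | cons s w ih =>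
    obtain ⟨k, rfl, hw⟩ := hw
    refine isTangle_cons.2 ⟨by simp only; omega, ?_⟩
    have e : s.left + s.piece.ins + k - s.piece.ins + s.piece.outs =
      s.left + s.piece.outs + k := by omega
    simp only [e]
    exact ih hw

/-! ### Side by side composition of four-ended tangles -/

namespace Eqv

theorem beside {A A' B B' : Word} (hA : Eqv 2 A A') (hB : Eqv 2 B B') (tA : IsTangle 2 A 2) :
    Eqv 2 (beside A B) (beside A' B') := by
  have tA' : IsTangle 2 A' 2 := hA.isTangle_iff.1 tA
  refine .cons' ?_
  rw [List.append_assoc, List.append_assoc]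
  refine .trans ((hA.add_right 2).append_right _) ?_
  exact append_widen tA' ((hB.shift 2).append_right _)

theorem above {A A' B B' : Word} (hA : Eqv 2 A A') (hB : Eqv 2 B B') (tB : IsTangle 2 B 2) :
    Eqv 2 (above A B) (above A' B') :=
  (append_left tB hA).trans (hB.append_right _)

theorem beside_horizontalLines {A : Word} (hA : IsTangle 2 A 2) :
    Eqv 2 (_root_.beside A horizontalLines) A := by
  have t : IsTangle 2 [⟨0, .cap⟩] 0 := ⟨0, rfl, rfl⟩
  have h := interchange (m := 4) hA t (by omega) []
  simp only [Word.shift_cons, Word.shift_nil, List.cons_append, List.nil_append,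
    zero_add, List.append_nil] at h
  calc
    Eqv 2 (⟨1, .cup⟩ :: (A ++ [⟨2, .cap⟩, ⟨2, .cup⟩] ++ [⟨1, .cap⟩]))
      (⟨1, .cup⟩ :: (A ++ [⟨2, .cap⟩])) := by
        refine .cons' ?_
        rw [List.append_assoc]
        refine append_widen (m := 4) hA (.cons' ?_)
        exact .fwd (.zigzag_left 1) []
    Eqv 2 _ (⟨1, .cup⟩ :: ⟨2, .cap⟩ :: A) := .cons' h.mono
    Eqv 2 _ A := .fwd (.zigzag_right 1) A

theorem horizontalLines_beside {A : Word} (hA : IsTangle 2 A 2) :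
    Eqv 2 (_root_.beside horizontalLines A) A := by
  have t : IsTangle 0 [⟨0, .cup⟩] 2 := ⟨0, rfl, rfl⟩
  have h := interchange (m := 2) t hA (by omega) [⟨1, .cap⟩]
  simp only [Word.shift_zero, List.cons_append, List.nil_append] at h
  calc
    Eqv 2 (⟨1, .cup⟩ :: ⟨0, .cap⟩ :: ⟨0, .cup⟩ :: (Word.shift 2 A ++ [⟨1, .cap⟩]))
      (⟨0, .cup⟩ :: (Word.shift 2 A ++ [⟨1, .cap⟩])) := .fwd (.zigzag_left 0) _
    Eqv 2 _ (A ++ [⟨0, .cup⟩, ⟨1, .cap⟩]) := h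
    Eqv 2 _ (A ++ []) := append_left hA (.fwd (.zigzag_right 0) [])
    Eqv 2 _ A := of_eq (List.append_nil A)

theorem beside_assoc {A B C : Word} (hA : IsTangle 2 A 2) (hB : IsTangle 2 B 2)
    (hC : IsTangle 2 C 2) :
    Eqv 2 (_root_.beside (_root_.beside A B) C) (_root_.beside A (_root_.beside B C)) := by
  have tcap : IsTangle 3 [⟨1, .cap⟩] 1 := ⟨0, rfl, rfl⟩
  have tcup : IsTangle 1 [⟨1, .cup⟩] 3 := ⟨0, rfl, rfl⟩
  have h₁ := interchange (m := 6) tcap (hC.shift 1) (by omega) [⟨1, .cap⟩]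
  have h₂ := interchange (m := 4) hA tcup (by omega)
    (Word.shift 2 B ++ (Word.shift 4 C ++ [⟨3, .cap⟩, ⟨1, .cap⟩]))
  simp only [Word.shift_shift, Word.shift_cons, Word.shift_nil, List.cons_append, List.nil_append,
    Nat.reduceAdd] at h₁ h₂
  calc
    Eqv 2 (_root_.beside (_root_.beside A B) C)
      (⟨1, .cup⟩ :: ⟨1, .cup⟩ ::
        (A ++ (Word.shift 2 B ++ ⟨1, .cap⟩ :: (Word.shift 2 C ++ [⟨1, .cap⟩])))) :=
        of_eq (by simp [_root_.beside])
    Eqv 2 _ (⟨1, .cup⟩ :: ⟨1, .cup⟩ ::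
        (A ++ (Word.shift 2 B ++ (Word.shift 4 C ++ [⟨1, .cap⟩, ⟨1, .cap⟩])))) := by
        refine .cons' (.cons' ?_)
        exact append_widen (m := 6) hA (append_place (m := 6) hB 2 h₁)
    Eqv 2 _ (⟨1, .cup⟩ :: ⟨1, .cup⟩ ::
        (A ++ (Word.shift 2 B ++ (Word.shift 4 C ++ [⟨3, .cap⟩, ⟨1, .cap⟩])))) := by
        refine .cons' (.cons' ?_)
        refine append_widen (m := 6) hA (append_place (m := 6) hB 2 ?_)
        exact append_place (m := 6) hC 4 (.exchange (m := 6) [])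
    Eqv 2 _ (⟨1, .cup⟩ :: ⟨3, .cup⟩ ::
        (A ++ (Word.shift 2 B ++ (Word.shift 4 C ++ [⟨3, .cap⟩, ⟨1, .cap⟩])))) :=
        (Eqv.exchange _).symm
    Eqv 2 _ (⟨1, .cup⟩ ::
        (A ++ ⟨3, .cup⟩ :: (Word.shift 2 B ++ (Word.shift 4 C ++ [⟨3, .cap⟩, ⟨1, .cap⟩])))) :=
        .cons' h₂.symm.mono
    Eqv 2 _ (_root_.beside A (_root_.beside B C)) := of_eq (by simp [_root_.beside])

/-- Rotating a horizontal composition about a vertical axis exchanges its two factors. -/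
theorem rotate_beside {A B : Word} (hA : IsTangle 2 A 2) (hB : IsTangle 2 B 2) :
    Eqv 2 (Word.rotate 2 (_root_.beside A B))
      (_root_.beside (Word.rotate 2 B) (Word.rotate 2 A)) := by
  have h := interchange (m := 4) hB.rotate hA.rotate (by omega) [⟨1, .cap⟩]
  calc
    Eqv 2 (Word.rotate 2 (_root_.beside A B))
      (⟨1, .cup⟩ :: (Word.shift 2 (Word.rotate 2 A) ++
        (Word.rotate 2 B ++ [⟨1, .cap⟩]))) := by
        refine of_eq ?_
        have e₁ := Word.rotate_add hA 2
        have e₂ := Word.rotate_shift hB 2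
        simp only [Nat.reduceAdd] at e₁ e₂
        simp only [_root_.beside, Word.rotate, Piece.ins, Piece.outs, List.append_assoc]
        simp only [Nat.reduceAdd, Nat.reduceSub]
        rw [Word.rotate_append (hA.add_right 2), Word.rotate_append (hB.shift 2)]
        simp [e₁, e₂, Word.rotate, Piece.ins]
    Eqv 2 _ (⟨1, .cup⟩ :: (Word.rotate 2 B ++
        (Word.shift 2 (Word.rotate 2 A) ++ [⟨1, .cap⟩]))) :=
        .cons' h.symm.mono
    Eqv 2 _ _ := of_eq (by simp [_root_.beside])

end Eqv

/-! ### Opening the link of a pair of trees at its last leaf -/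

/-- The tangle of a comb in the lower half plane, without the strand sprouting from the root. -/
def combStrands : ℕ → Word
  | 0 => []
  | k + 1 => ⟨1, .cup⟩ :: ⟨0, .neg⟩ :: Word.shift 2 (combStrands k)

theorem isTangle_combStrands (k : ℕ) : IsTangle 1 (combStrands k) (2 * k + 1) := by
  induction k with
  | zero => rfl
  | succ k ih => exact ⟨0, rfl, 1, rfl, ih.shift 2⟩

theorem combStrands_add (k l : ℕ) :
    combStrands (k + l) = combStrands k ++ Word.shift (2 * k) (combStrands l) := by
  induction k with
  | zero => simp [combStrands]
  | succ k ih =>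
    rw [show k + 1 + l = k + l + 1 by omega]
    simp only [combStrands, ih, Word.shift_append, Word.shift_shift, List.cons_append]
    rw [Nat.mul_succ]

namespace Word

theorem vflip_append (w v : Word) :
    Word.vflip (w ++ v) = Word.vflip v ++ Word.vflip w := by
  simp [Word.vflip]

theorem vflip_shift (k : ℕ) (w : Word) :
    Word.vflip (Word.shift k w) = Word.shift k (Word.vflip w) := by
  simp [Word.vflip, Word.shift, Function.comp_def]

end Word

theorem BTree.vflip_strands_comb (k : ℕ) :
    Word.vflip (BTree.comb k).strands = combStrands k := by
  induction k with
  | zero => rfl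
  | succ k ih =>
    rw [BTree.comb, BTree.strands, BTree.strands, List.nil_append, Word.vflip_append,
      Word.vflip_shift, ih]
    rfl

theorem BTree.carets_comb (k : ℕ) : (BTree.comb k).carets = k := by
  induction k with
  | zero => rfl
  | succ k ih => simp [BTree.comb, BTree.carets, ih]

theorem BTree.vflip_upper_comb (k : ℕ) :
    Word.vflip (BTree.comb k).upper = ⟨0, .cup⟩ :: Word.shift 1 (combStrands k) := by
  rw [BTree.upper, Word.vflip_append, Word.vflip_shift, BTree.vflip_strands_comb]
  rfl

/-- The four-ended tangle obtained, up to isotopy, from the diagram of the pair of `T` and a comb by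
cutting the strands at the leftmost point of the axis and at the last leaf: the branches to the left
of the right edge of `T` contribute horizontal summands. -/
def BTree.opened : BTree → Word
  | leaf => horizontalLines
  | node l r => beside (above [⟨0, .pos⟩] (beside l.opened [⟨0, .neg⟩])) r.opened

theorem isTangle_pos : IsTangle 2 [⟨0, .pos⟩] 2 := ⟨0, rfl, rfl⟩

theorem isTangle_neg : IsTangle 2 [⟨0, .neg⟩] 2 := ⟨0, rfl, rfl⟩

namespace BTree

theorem isTangle_opened (T : BTree) : IsTangle 2 T.opened 2 := by
  induction T with
  | leaf => exact isTangle_horizontalLines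
  | node l r hl hr =>
    exact IsTangle.beside (IsTangle.above isTangle_pos (IsTangle.beside hl isTangle_neg)) hr

/-- In front of the right branch, the crossings at a caret and the left branch form a horizontal
composition with a negative crossing. -/
theorem eqv_beside_neg {T : BTree} {O : Word} (hT : Eqv 2
      (combStrands T.carets ++ ⟨2 * T.carets, .cap⟩ :: ⟨2 * T.carets, .cup⟩ :: T.strands) O) (u : Word) :
    Eqv 2 (combStrands T.carets ++ ⟨2 * T.carets + 1, .cup⟩ :: ⟨2 * T.carets, .neg⟩ ::
        (T.strands ++ u))
      (⟨1, .cup⟩ :: ⟨1, .cup⟩ :: (O ++ ⟨2, .neg⟩ :: ⟨1, .cap⟩ :: u)) := by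
  have tS := T.isTangle_strands
  have tD := isTangle_combStrands T.carets
  set c := T.carets
  set D := combStrands c
  set S := T.strands
  have tcup : IsTangle 0 [⟨0, .cup⟩] 2 := ⟨0, rfl, rfl⟩
  have ttop : IsTangle 3 [⟨1, .neg⟩, ⟨0, .cap⟩] 1 := ⟨0, rfl, 1, rfl, rfl⟩
  have hcup : ∀ {n : ℕ} (v : Word), 1 ≤ n →
      Eqv n (D ++ ⟨2 * c + 1, .cup⟩ :: v) (⟨1, .cup⟩ :: (D ++ v)) := by
    intro n v hn
    have := Eqv.interchange (m := n) tD tcup (by omega) v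
    simpa using this
  refine Eqv.symm ?_
  calc
    Eqv 2 (⟨1, .cup⟩ :: ⟨1, .cup⟩ :: (O ++ ⟨2, .neg⟩ :: ⟨1, .cap⟩ :: u))
      (⟨1, .cup⟩ :: ⟨1, .cup⟩ :: (D ++ ⟨2 * c, .cap⟩ :: ⟨2 * c, .cup⟩ ::
        (S ++ ⟨2, .neg⟩ :: ⟨1, .cap⟩ :: u))) := by
        refine .cons' (.cons' ?_)
        have := (hT.symm.add_right 4).append_right (⟨2, .neg⟩ :: ⟨1, .cap⟩ :: u)
        simp only [List.append_assoc, List.cons_append] at this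
        exact this
    Eqv 2 _ (⟨1, .cup⟩ :: (D ++ ⟨2 * c + 1, .cup⟩ :: ⟨2 * c, .cap⟩ :: ⟨2 * c, .cup⟩ ::
        (S ++ ⟨2, .neg⟩ :: ⟨1, .cap⟩ :: u))) :=
        .cons' (hcup _ (by simp only [Piece.ins, Piece.outs]; omega)).symm
    Eqv 2 _ (⟨1, .cup⟩ :: (D ++ ⟨2 * c, .cup⟩ ::
        (S ++ ⟨2, .neg⟩ :: ⟨1, .cap⟩ :: u))) :=
        .cons' (.append_widen tD
          (.fwd (.zigzag_left (2 * c)) _))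
    Eqv 2 _ (⟨1, .cup⟩ :: (D ++ ⟨2 * c, .cup⟩ ::
        (⟨2 * c + 2, .neg⟩ :: ⟨2 * c + 1, .cap⟩ :: (S ++ u)))) := by
        refine .cons' (.append_widen tD
          (.cons' ?_))
        have := Eqv.interchange (m := 2 * c + 5) tS ttop (by omega) u
        simp only [Word.shift_cons, Word.shift_nil, List.cons_append, List.nil_append,
          zero_add, Nat.reduceAdd, Nat.add_comm 1] at this
        exact this.mono
    Eqv 2 _ (D ++ ⟨2 * c + 1, .cup⟩ :: ⟨2 * c, .cup⟩ ::
        (⟨2 * c + 2, .neg⟩ :: ⟨2 * c + 1, .cap⟩ :: (S ++ u))) := (hcup _ (by omega)).symm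
    Eqv 2 _ (D ++ ⟨2 * c + 1, .cup⟩ :: ⟨2 * c, .neg⟩ :: (S ++ u)) := by
        refine .append_widen tD (.cons' ?_)
        simp only [Piece.ins, Piece.outs]
        set n := 2 - 1 + (2 * c + 1) - 0 + 2
        have hn : n = 2 * c + 4 := by omega
        rw [hn]
        calc
          Eqv (2 * c + 4)
            (⟨2 * c, .cup⟩ :: ⟨2 * c + 2, .neg⟩ :: ⟨2 * c + 1, .cap⟩ :: (S ++ u))
            (⟨2 * c, .cup⟩ :: ⟨2 * c + 1, .pos⟩ :: ⟨2 * c + 2, .cap⟩ :: (S ++ u)) :=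
              .cons' (.fwd (.slide_cap_neg (2 * c + 1)) _)
          Eqv (2 * c + 4) _ (⟨2 * c + 1, .cup⟩ :: ⟨2 * c, .neg⟩ :: ⟨2 * c + 2, .cap⟩ :: (S ++ u)) :=
              .fwd (.slide_cup_pos (2 * c)) (⟨2 * c + 2, .cap⟩ :: (S ++ u))
          Eqv (2 * c + 4) _ (⟨2 * c + 1, .cup⟩ :: ⟨2 * c + 2, .cap⟩ :: ⟨2 * c, .neg⟩ :: (S ++ u)) :=
              .cons' (.exchange _)
          Eqv (2 * c + 4) _ _ := .fwd (.zigzag_right (2 * c + 1)) _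

theorem eqv_opened (T : BTree) :
    Eqv 2 (combStrands T.carets ++ ⟨2 * T.carets, .cap⟩ :: ⟨2 * T.carets, .cup⟩ :: T.strands)
      T.opened := by
  induction T with
  | leaf => exact .refl _ _
  | node l r hl hr =>
    have tOl := l.isTangle_opened
    have tOr := r.isTangle_opened
    have tl := l.isTangle_strands
    have tr := r.isTangle_strands
    have tDl := isTangle_combStrands l.carets
    have tDr := isTangle_combStrands r.carets
    have e : combStrands (l.node r).carets = combStrands l.carets ++
        ⟨2 * l.carets + 1, .cup⟩ :: ⟨2 * l.carets, .neg⟩ ::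
          Word.shift (2 * l.carets + 2) (combStrands r.carets) := by
      rw [carets, add_assoc, combStrands_add]
      simp [combStrands, add_comm]
    have e' : 2 * (l.node r).carets = 2 * r.carets + (2 * l.carets + 2) := by
      rw [carets]; omega
    rw [e, e', opened, strands]
    set c := l.carets
    have h₁ := Eqv.interchange (m := 2 * c + 1 + (2 * r.carets + 1 + 1)) tl (tr.shift 1) (by omega)
      [⟨0, .pos⟩, ⟨1, .cap⟩]
    have h₂ := Eqv.interchange (m := 2 * c + 4) tl (tOr.shift 1) (by omega)
      [⟨0, .pos⟩, ⟨1, .cap⟩]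
    have h₃ := Eqv.interchange (m := 4) isTangle_pos tOr (by omega) [⟨1, .cap⟩]
    have hr' := (hr.shift (2 * c + 2)).append_right (l.strands ++ [⟨0, .pos⟩, ⟨1, .cap⟩])
    simp only [Word.shift_shift, Word.shift_append, Word.shift_cons, List.append_assoc,
      List.cons_append, List.nil_append, Nat.reduceAdd, Nat.add_comm 1] at h₁ h₂ h₃ hr'
    calc
      Eqv 2 _ (combStrands c ++ ⟨2 * c + 1, .cup⟩ :: ⟨2 * c, .neg⟩ ::
          (Word.shift (2 * c + 2) (combStrands r.carets) ++
            ⟨2 * r.carets + (2 * c + 2), .cap⟩ :: ⟨2 * r.carets + (2 * c + 2), .cup⟩ ::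
              (l.strands ++ (Word.shift 2 r.strands ++ [⟨0, .pos⟩, ⟨1, .cap⟩])))) :=
        .of_eq (by simp)
      Eqv 2 _ (combStrands c ++ ⟨2 * c + 1, .cup⟩ :: ⟨2 * c, .neg⟩ ::
          (Word.shift (2 * c + 2) (combStrands r.carets) ++
            ⟨2 * r.carets + (2 * c + 2), .cap⟩ :: ⟨2 * r.carets + (2 * c + 2), .cup⟩ ::
              (Word.shift (2 * c + 2) r.strands ++ (l.strands ++ [⟨0, .pos⟩, ⟨1, .cap⟩])))) := by
        refine .append_widen tDl (.cons'
          (.cons' (.append_place tDr _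
            (.cons' (.cons' h₁.mono)))))
      Eqv 2 _ (combStrands c ++ ⟨2 * c + 1, .cup⟩ :: ⟨2 * c, .neg⟩ ::
          (Word.shift (2 * c + 2) r.opened ++ (l.strands ++ [⟨0, .pos⟩, ⟨1, .cap⟩]))) := by
        refine .append_widen tDl (.cons'
          (.cons' hr'.mono))
      Eqv 2 _ (combStrands c ++ ⟨2 * c + 1, .cup⟩ :: ⟨2 * c, .neg⟩ ::
          (l.strands ++ (Word.shift 2 r.opened ++ [⟨0, .pos⟩, ⟨1, .cap⟩]))) := by
        refine .append_widen tDl (.cons'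
          (.cons' h₂.symm.mono))
      Eqv 2 _ (⟨1, .cup⟩ :: ⟨1, .cup⟩ :: (l.opened ++ ⟨2, .neg⟩ :: ⟨1, .cap⟩ ::
          (Word.shift 2 r.opened ++ [⟨0, .pos⟩, ⟨1, .cap⟩]))) :=
        eqv_beside_neg hl _
      Eqv 2 _ (⟨1, .cup⟩ :: ⟨1, .cup⟩ :: (l.opened ++ ⟨2, .neg⟩ :: ⟨1, .cap⟩ :: ⟨0, .pos⟩ ::
          (Word.shift 2 r.opened ++ [⟨1, .cap⟩]))) := by
        refine .cons' (.cons' ?_)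
        exact .append_widen tOl (.cons'
          (.cons' h₃.symm))
      Eqv 2 _ _ := .of_eq (by simp [beside, above])

/-- The diagram of a tree and a comb, cut only at the leftmost point of the axis. -/
theorem eqv_cup_opened_cap (T : BTree) :
    Eqv 1 (combStrands T.carets ++ T.strands) (⟨1, .cup⟩ :: (T.opened ++ [⟨1, .cap⟩])) := by
  have tS := T.isTangle_strands
  have tD := isTangle_combStrands T.carets
  have hT := (T.eqv_opened.add_right 1).append_right [⟨1, .cap⟩]
  set c := T.carets
  have tcup : IsTangle 0 [⟨0, .cup⟩] 2 := ⟨0, rfl, rfl⟩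
  have tcap : IsTangle 2 [⟨0, .cap⟩] 0 := ⟨0, rfl, rfl⟩
  have h₁ := Eqv.interchange (m := 1) tD tcup (by omega)
    (⟨2 * c, .cap⟩ :: ⟨2 * c, .cup⟩ :: ⟨2 * c + 1, .cap⟩ :: T.strands)
  have h₂ := Eqv.interchange (m := 2 * c + 3) tS tcap (by omega) []
  simp only [Word.shift_cons, Word.shift_nil, List.append_assoc, List.append_nil,
    List.cons_append, List.nil_append, zero_add] at h₁ h₂ hT
  refine Eqv.symm ?_
  calc
    Eqv 1 _ (⟨1, .cup⟩ :: (combStrands c ++ ⟨2 * c, .cap⟩ :: ⟨2 * c, .cup⟩ ::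
        (T.strands ++ [⟨1, .cap⟩]))) := .cons' hT.symm.mono
    Eqv 1 _ (⟨1, .cup⟩ :: (combStrands c ++ ⟨2 * c, .cap⟩ :: ⟨2 * c, .cup⟩ ::
        ⟨2 * c + 1, .cap⟩ :: T.strands)) := by
      refine .cons' (.append_widen tD
        (.cons' (.cons' h₂.mono)))
    Eqv 1 _ (combStrands c ++ ⟨2 * c + 1, .cup⟩ :: ⟨2 * c, .cap⟩ :: ⟨2 * c, .cup⟩ ::
        ⟨2 * c + 1, .cap⟩ :: T.strands) := h₁.symm
    Eqv 1 _ (combStrands c ++ ⟨2 * c, .cup⟩ :: ⟨2 * c + 1, .cap⟩ :: T.strands) :=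
      .append_widen tD (.fwd (.zigzag_left (2 * c)) _)
    Eqv 1 _ (combStrands c ++ T.strands) :=
      .append_widen tD (.fwd (.zigzag_right (2 * c)) _)

/-- The image of the tangle `T.opened` under the rotation by the angle `π` about a vertical axis,
in arborescent form. -/
def summands : BTree → Word
  | leaf => horizontalLines
  | node l r => beside r.summands (above [⟨0, .pos⟩] (beside [⟨0, .neg⟩] l.summands))

theorem isTangle_summands (T : BTree) : IsTangle 2 T.summands 2 := by
  induction T with
  | leaf => exact isTangle_horizontalLines
  | node l r hl hr =>
    exact IsTangle.beside hr (IsTangle.above isTangle_pos (IsTangle.beside isTangle_neg hl))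

/-- The rotation is carried out on the diagram itself: it is not known beforehand to respect
equivalence. -/
theorem rotate_opened (T : BTree) : Eqv 2 (Word.rotate 2 T.opened) T.summands := by
  induction T with
  | leaf => exact .refl _ _
  | node l r hl hr =>
    have tl := l.isTangle_opened
    have tb := IsTangle.beside tl isTangle_neg
    refine (Eqv.rotate_beside (IsTangle.above isTangle_pos tb) r.isTangle_opened).trans
      (Eqv.beside hr ?_ r.isTangle_opened.rotate)
    rw [above, Word.rotate_append tb]
    refine ((Eqv.rotate_beside tl isTangle_neg).append_right _).trans ?_
    exact Eqv.above (.refl _ _) (Eqv.beside (.refl _ _) hl isTangle_neg)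
      (IsTangle.beside isTangle_neg tl.rotate)

/-- The link of the pair of `T` and a comb in terms of the arborescent tangle `T.summands`, whose
ends are joined on the left-hand side. -/
theorem eqv_thompson (T : BTree) :
    Eqv 0 (Word.vflip (comb T.carets).upper ++ T.upper)
      (⟨0, .cup⟩ :: ⟨1, .cup⟩ :: (Word.shift 2 T.summands ++ [⟨1, .cap⟩, ⟨0, .cap⟩])) := by
  have tO := T.isTangle_opened
  have t₁ : IsTangle 1 (⟨1, .cup⟩ :: (T.opened ++ [⟨1, .cap⟩])) 1 :=
    ⟨0, rfl, (tO.add_right 1).append ⟨0, rfl, rfl⟩⟩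
  have e : Word.rotate 1 (⟨1, .cup⟩ :: (T.opened ++ [⟨1, .cap⟩])) =
      ⟨0, .cup⟩ :: (Word.shift 1 (Word.rotate 2 T.opened) ++ [⟨0, .cap⟩]) := by
    have := Word.rotate_add tO 1
    simp only [Nat.reduceAdd] at this
    simp only [Word.rotate, Piece.ins, Piece.outs]
    simp only [Nat.reduceAdd, Nat.reduceSub]
    rw [Word.rotate_append (tO.add_right 1), this]
    rfl
  have h₁ := T.eqv_cup_opened_cap.trans (Eqv.rotate_one t₁)
  rw [e] at h₁
  have h₂ := h₁.trans (.cons'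
    ((T.rotate_opened.shift 1).append_right [⟨0, .cap⟩]))
  have h₃ := (h₂.shift 1).append_right [⟨0, .cap⟩]
  simp only [Word.shift_append, Word.shift_cons, Word.shift_nil, Word.shift_shift,
    List.append_assoc, List.cons_append, List.nil_append, Nat.reduceAdd, zero_add] at h₃
  rw [vflip_upper_comb, upper, List.cons_append]
  exact .cons' h₃

end BTree

/-! ### Bipartite trees and binary trees -/

/-- The branches at the root of the bipartite tree that corresponds to a binary tree `T`: one for
each branch of `T` to the left of its right edge, the lowest one first. -/
def BTree.branches : BTree → List WTree
  | leaf => []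
  | node l r => r.branches ++ [.node 1 [.node (-1) l.branches]]

/-- The bipartite tree that corresponds to a binary tree. -/
def BTree.bipartite (T : BTree) : WTree := .node (-1) T.branches

namespace WTree

theorem isBipartite_node {ts : List WTree}
    (h : ∀ t ∈ ts, t.weight = 1 ∧ t.BipartiteBranch) : (WTree.node (-1) ts).IsBipartite :=
  ⟨rfl, .node _ _ (.inr rfl) (fun t ht => by simpa using (h t ht).1) (fun _ => rfl)
    (fun h => by norm_num at h) fun t ht => (h t ht).2⟩

/-- A bipartite tree becomes a branch of a larger one below a new vertex of weight `1`. -/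
theorem IsBipartite.hang {t : WTree} (h : t.IsBipartite) :
    (WTree.node 1 [t]).weight = 1 ∧ (WTree.node 1 [t]).BipartiteBranch := by
  refine ⟨rfl, .node _ _ (.inl rfl) ?_ (by simp) (by simp) ?_⟩
  · simpa using h.1
  · simpa using h.2

end WTree

namespace BTree

theorem branches_valid (T : BTree) :
    ∀ t ∈ T.branches, t.weight = 1 ∧ t.BipartiteBranch := by
  induction T with
  | leaf => simp [branches]
  | node l r hl hr =>
    intro t ht
    rcases List.mem_append.1 ht with h | h
    · exact hr t h
    · rw [List.mem_singleton.1 h]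
      exact (WTree.isBipartite_node hl).hang

/-- The branches of bipartite trees are exactly those given by binary trees.  Vertices of both weights
are treated together, since they alternate. -/
theorem exists_bipartite_eq {t : WTree} (h : t.BipartiteBranch) :
    (t.weight = -1 → ∃ S : BTree, t = S.bipartite) ∧
      (t.weight = 1 → ∃ S : BTree, t = .node 1 [S.bipartite]) := by
  induction h with
  | node w ts sign opposite leaf degree branches ih =>
    constructor
    · rintro rfl
      suffices ∃ S : BTree, ts = S.branches by
        obtain ⟨S, rfl⟩ := this
        exact ⟨S, rfl⟩
      have hts : ∀ t ∈ ts, ∃ S : BTree, t = .node 1 [S.bipartite] := fun t ht =>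
        (ih t ht).2 (by simpa using opposite t ht)
      clear * - hts
      induction ts using List.reverseRecOn with
      | nil => exact ⟨.leaf, rfl⟩
      | append_singleton ts t ih =>
        obtain ⟨r, rfl⟩ := ih fun t ht => hts t (by simp [ht])
        obtain ⟨l, rfl⟩ := hts t (by simp)
        exact ⟨.node l r, rfl⟩
    · rintro rfl
      obtain ⟨t, rfl⟩ := List.length_eq_one_iff.1 (degree rfl)
      obtain ⟨S, rfl⟩ := (ih t (by simp)).1 (opposite t (by simp))
      exact ⟨S, rfl⟩

end BTree

theorem eqv_horizontalTwist_neg_one : Eqv 2 (horizontalTwist (-1)) [⟨0, .neg⟩] :=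
  Eqv.beside_horizontalLines (A := [⟨0, .neg⟩]) isTangle_neg

theorem eqv_besideAll_append (ts us : List WTree) :
    Eqv 2 (besideAll (ts ++ us)) (beside (besideAll ts) (besideAll us)) := by
  induction ts with
  | nil =>
    rw [List.nil_append, besideAll]
    exact (Eqv.horizontalLines_beside (isTangle_besideAll us)).symm
  | cons t ts ih =>
    rw [List.cons_append, besideAll, besideAll]
    exact (Eqv.beside (.refl _ _) ih t.isTangle_vertical).trans
      (Eqv.beside_assoc t.isTangle_vertical (isTangle_besideAll ts) (isTangle_besideAll us)).symm

theorem eqv_horizontal {ts : List WTree} {B : Word} (h : Eqv 2 (besideAll ts) B) :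
    Eqv 2 (WTree.node (-1) ts).horizontal (beside [⟨0, .neg⟩] B) := by
  rw [WTree.horizontal]
  exact Eqv.beside eqv_horizontalTwist_neg_one h (isTangle_horizontalTwist _)

theorem eqv_vertical {ts : List WTree} {B : Word} (h : Eqv 2 (besideAll ts) B) :
    Eqv 2 (WTree.node 1 [.node (-1) ts]).vertical
      (above [⟨0, .pos⟩] (beside [⟨0, .neg⟩] B)) := by
  have e : (WTree.node 1 [.node (-1) ts]).vertical =
      above [⟨0, .pos⟩] (WTree.node (-1) ts).horizontal := by
    simp [WTree.vertical, aboveAll, above, verticalTwist, verticalLines, crossing]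
  rw [e]
  exact Eqv.above (.refl _ _) (eqv_horizontal h) (WTree.isTangle_horizontal _)

namespace BTree

theorem eqv_besideAll_branches (T : BTree) : Eqv 2 (besideAll T.branches) T.summands := by
  induction T with
  | leaf => rw [branches, besideAll]; exact .refl _ _
  | node l r hl hr =>
    refine (eqv_besideAll_append _ _).trans (Eqv.beside hr ?_ (isTangle_besideAll _))
    simp only [besideAll]
    exact (Eqv.beside_horizontalLines (WTree.isTangle_vertical _)).trans (eqv_vertical hl)

end BTree

/-! ### Closures of bipartite trees -/

theorem eqv_closureWord {A B : Word} (h : Eqv 2 A B) :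
    Eqv 0 (closureWord A) (closureWord B) :=
  .cons' (h.append_right _).mono

/-- A branch that is a vertical pair of strands absorbs the crossing at the root. -/
theorem eqv_closureWord_vertical {B : Word} (hB : IsTangle 2 B 2) :
    Eqv 0 (closureWord (beside [⟨0, .neg⟩] (beside [] B)))
      (⟨0, .cup⟩ :: ⟨1, .cup⟩ :: (Word.shift 2 B ++ [⟨1, .cap⟩, ⟨0, .cap⟩])) := by
  have tN : IsTangle 1 (⟨0, .cup⟩ :: (Word.shift 1 B ++ [⟨0, .cap⟩])) 1 :=
    ⟨1, rfl, (hB.shift 1).append ⟨1, rfl, rfl⟩⟩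
  have tcap : IsTangle 3 [⟨1, .cap⟩] 1 := ⟨0, rfl, rfl⟩
  have h₁ := Eqv.interchange (m := 4) tcap tN (by omega) [⟨0, .cap⟩]
  simp only [Word.shift_append, Word.shift_cons, Word.shift_nil, Word.shift_shift,
    List.append_assoc, List.cons_append, List.nil_append, Nat.reduceAdd, zero_add] at h₁
  calc
    Eqv 0 _ (⟨0, .cup⟩ :: ⟨1, .cup⟩ :: ⟨0, .neg⟩ :: ⟨3, .cup⟩ ::
        (Word.shift 4 B ++ [⟨3, .cap⟩, ⟨1, .cap⟩, ⟨0, .cap⟩])) :=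
      .of_eq (by simp [closureWord, beside])
    Eqv 0 _ (⟨0, .cup⟩ :: ⟨1, .cup⟩ :: ⟨0, .neg⟩ :: ⟨1, .cap⟩ :: ⟨1, .cup⟩ ::
        (Word.shift 2 B ++ [⟨1, .cap⟩, ⟨0, .cap⟩])) :=
      .cons' (.cons' (.cons' h₁.symm.mono))
    Eqv 0 _ (⟨0, .cup⟩ :: ⟨0, .cup⟩ :: ⟨1, .pos⟩ :: ⟨1, .cap⟩ :: ⟨1, .cup⟩ ::
        (Word.shift 2 B ++ [⟨1, .cap⟩, ⟨0, .cap⟩])) :=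
      .cons' (.bwd (.slide_cup_pos 0) _)
    Eqv 0 _ (⟨0, .cup⟩ :: ⟨0, .cup⟩ :: ⟨1, .cap⟩ :: ⟨1, .cup⟩ ::
        (Word.shift 2 B ++ [⟨1, .cap⟩, ⟨0, .cap⟩])) :=
      .cons' (.cons' (.fwd (.reidemeister_one_cap_pos 1) _))
    Eqv 0 _ (⟨0, .cup⟩ :: ⟨1, .cup⟩ ::
        (Word.shift 2 B ++ [⟨1, .cap⟩, ⟨0, .cap⟩])) :=
      .cons' (.fwd (.zigzag_right 0) _)

/-- The link of the pair of `T` and a comb is the closure of a bipartite tree, obtained from the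
bipartite tree of `T` by adding a branch with two vertices as the first branch at the root. -/
theorem BTree.eqv_closure_cons_branches (T : BTree) :
    Eqv 0 (closureWord (WTree.node (-1) (.node 1 [.node (-1) []] :: T.branches)).tangle)
      (⟨0, .cup⟩ :: ⟨1, .cup⟩ :: (Word.shift 2 T.summands ++ [⟨1, .cap⟩, ⟨0, .cap⟩])) := by
  refine .trans (eqv_closureWord ?_) (eqv_closureWord_vertical T.isTangle_summands)
  refine eqv_horizontal ?_
  rw [besideAll]
  refine Eqv.beside ?_ T.eqv_besideAll_branches (WTree.isTangle_vertical _)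
  refine (eqv_vertical (B := horizontalLines) (by rw [besideAll]; exact .refl _ _)).trans ?_
  refine (Eqv.above (.refl _ _) (Eqv.beside_horizontalLines isTangle_neg)
    (IsTangle.beside isTangle_neg isTangle_horizontalLines)).trans ?_
  exact .fwd (.reidemeister_two_neg_pos 0) []

/-- Two levels of a binary tree without right branches undo each other, up to the place where the
ends of the tangle are joined. -/
theorem eqv_cancel {Y : Word} (hY : IsTangle 2 Y 2) :
    Eqv 1 (⟨0, .cup⟩ :: ⟨2, .cup⟩ :: ⟨1, .neg⟩ ::
        (Word.shift 3 Y ++ [⟨3, .pos⟩, ⟨2, .cap⟩, ⟨1, .pos⟩, ⟨0, .cap⟩]))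
      (⟨0, .cup⟩ :: (Word.shift 1 Y ++ [⟨1, .cap⟩])) := by
  have t₁ : IsTangle 3 (Word.shift 1 Y ++ [⟨1, .pos⟩, ⟨0, .cap⟩]) 1 :=
    (hY.shift 1).append ⟨0, rfl, 1, rfl, rfl⟩
  have t₂ : IsTangle 2 (Y ++ [⟨0, .pos⟩]) 2 := hY.append isTangle_pos
  have tcup : IsTangle 1 [⟨1, .cup⟩] 3 := ⟨0, rfl, rfl⟩
  have h₁ := Eqv.interchange (m := 5) isTangle_pos t₁ (by omega) [⟨1, .pos⟩, ⟨0, .cap⟩]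
  have h₂ := Eqv.interchange (m := 3) tcup t₂ (by omega) [⟨2, .cap⟩, ⟨1, .cap⟩]
  simp only [Word.shift_append, Word.shift_cons, Word.shift_nil, Word.shift_shift,
    List.append_assoc, List.cons_append, List.nil_append, Nat.reduceAdd, zero_add] at h₁ h₂
  calc
    Eqv 1 _ (⟨0, .cup⟩ :: ⟨0, .cup⟩ :: ⟨1, .neg⟩ ::
        (Word.shift 3 Y ++ [⟨3, .pos⟩, ⟨2, .cap⟩, ⟨1, .pos⟩, ⟨0, .cap⟩])) :=
      .exchange _
    Eqv 1 _ (⟨0, .cup⟩ :: ⟨1, .cup⟩ :: ⟨0, .pos⟩ ::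
        (Word.shift 3 Y ++ [⟨3, .pos⟩, ⟨2, .cap⟩, ⟨1, .pos⟩, ⟨0, .cap⟩])) :=
      .cons' (.fwd (.slide_cup_neg 0) _)
    Eqv 1 _ (⟨0, .cup⟩ :: ⟨1, .cup⟩ ::
        (Word.shift 3 Y ++ [⟨3, .pos⟩, ⟨2, .cap⟩, ⟨0, .pos⟩, ⟨1, .pos⟩, ⟨0, .cap⟩])) :=
      .cons' (.cons' h₁.mono)
    Eqv 1 _ (⟨0, .cup⟩ :: ⟨1, .cup⟩ ::
        (Word.shift 3 Y ++ [⟨3, .pos⟩, ⟨2, .cap⟩, ⟨0, .pos⟩, ⟨0, .neg⟩, ⟨1, .cap⟩])) :=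
      .cons' (.cons' (.append_place hY _ (.cons' (.cons' (.cons'
        (.fwd (.slide_cap_pos 0) []))))))
    Eqv 1 _ (⟨0, .cup⟩ :: ⟨1, .cup⟩ ::
        (Word.shift 3 Y ++ [⟨3, .pos⟩, ⟨2, .cap⟩, ⟨1, .cap⟩])) :=
      .cons' (.cons' (.append_place hY _ (.cons' (.cons'
        (.fwd (.reidemeister_two_pos_neg 0) _)))))
    Eqv 1 _ (⟨0, .cup⟩ :: (Word.shift 1 Y ++
        [⟨1, .pos⟩, ⟨1, .cup⟩, ⟨2, .cap⟩, ⟨1, .cap⟩])) :=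
      .cons' h₂.mono
    Eqv 1 _ (⟨0, .cup⟩ :: (Word.shift 1 Y ++ [⟨1, .pos⟩, ⟨1, .cap⟩])) :=
      .cons' (.append_place hY _ (.cons' (.fwd (.zigzag_right 1) _)))
    Eqv 1 _ _ :=
      .cons' (.append_place hY _ (.fwd (.reidemeister_one_cap_pos 1) []))

/-- If the ends of `pos * (neg + pos * Y)` are joined on the left-hand side, the result is the closure
of `Y`. -/
theorem eqv_closureWord_of_cancel {Y : Word} (hY : IsTangle 2 Y 2) :
    Eqv 0 (⟨0, .cup⟩ :: ⟨1, .cup⟩ :: (Word.shift 2 (above [⟨0, .pos⟩]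
        (beside [⟨0, .neg⟩] (above [⟨0, .pos⟩] Y))) ++ [⟨1, .cap⟩, ⟨0, .cap⟩]))
      (closureWord Y) := by
  have t₁ : IsTangle 2 (Y ++ [⟨0, .cap⟩]) 0 := hY.append ⟨0, rfl, rfl⟩
  have tcap : IsTangle 2 [⟨0, .cap⟩] 0 := ⟨0, rfl, rfl⟩
  have h₁ := Eqv.interchange (m := 4) tcap t₁ (by omega) []
  have h₂ := ((eqv_cancel hY).shift 1).append_right [⟨0, .cap⟩]
  simp only [Word.shift_append, Word.shift_cons, Word.shift_nil, Word.shift_shift, Word.shift_zero,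
    List.append_assoc, List.cons_append, List.nil_append, List.append_nil, Nat.reduceAdd,
    zero_add] at h₁ h₂
  calc
    Eqv 0 _ (⟨0, .cup⟩ :: ⟨1, .cup⟩ :: ⟨3, .cup⟩ :: ⟨2, .neg⟩ :: (Word.shift 4 Y ++
        [⟨4, .pos⟩, ⟨3, .cap⟩, ⟨2, .pos⟩, ⟨1, .cap⟩, ⟨0, .cap⟩])) :=
      .of_eq (by simp [above, beside])
    Eqv 0 _ (⟨0, .cup⟩ :: ⟨1, .cup⟩ :: (Word.shift 2 Y ++ [⟨2, .cap⟩, ⟨0, .cap⟩])) :=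
      .cons' h₂.mono
    Eqv 0 _ (⟨0, .cup⟩ :: ⟨1, .cup⟩ :: ⟨0, .cap⟩ :: (Y ++ [⟨0, .cap⟩])) :=
      .cons' (.cons' h₁.symm.mono)
    Eqv 0 _ (closureWord Y) := .cons' (.fwd (.zigzag_left 0) _)

/-- The closure of the bipartite tree of `S` is the link of a pair of trees. -/
theorem BTree.eqv_closure_bipartite (S : BTree) :
    Eqv 0 (⟨0, .cup⟩ :: ⟨1, .cup⟩ ::
        (Word.shift 2 ((S.node leaf).node leaf).summands ++ [⟨1, .cap⟩, ⟨0, .cap⟩]))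
      (closureWord S.bipartite.tangle) := by
  have hY := IsTangle.beside isTangle_neg S.isTangle_summands
  have hX := IsTangle.above isTangle_pos hY
  have h₁ := Eqv.horizontalLines_beside hX
  have h₂ := Eqv.beside (.refl 2 [⟨0, .neg⟩]) h₁ isTangle_neg
  have h₃ := Eqv.above (.refl 2 [⟨0, .pos⟩]) h₂
    (IsTangle.beside isTangle_neg (IsTangle.beside isTangle_horizontalLines hX))
  have h₄ := (Eqv.horizontalLines_beside (IsTangle.above isTangle_pos
    (IsTangle.beside isTangle_neg (IsTangle.beside isTangle_horizontalLines hX)))).trans h₃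
  refine .trans (.cons' (.cons' ((h₄.shift 2).append_right _).mono)) ?_
  exact (eqv_closureWord_of_cancel hY).trans
    (eqv_closureWord (eqv_horizontal S.eqv_besideAll_branches)).symm

/-! ### Positive elements of the Thompson group -/

/-- The homeomorphism `g` maps the interval `p` affinely onto the interval `q`; both intervals are
nondegenerate, and `p` matters only within the unit interval. -/
def MapsInterval (g : unitInterval ≃o unitInterval) (p q : ℝ × ℝ) : Prop :=
  p.1 < p.2 ∧ q.1 < q.2 ∧ ∀ x : unitInterval, p.1 ≤ x → (x : ℝ) ≤ p.2 →
    (g x : ℝ) = q.1 + (q.2 - q.1) / (p.2 - p.1) * (x - p.1)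

theorem MapsInterval.comp {f g : unitInterval ≃o unitInterval} {p q r : ℝ × ℝ}
    (hf : MapsInterval f q r) (hg : MapsInterval g p q) : MapsInterval (f * g) p r := by
  obtain ⟨hp, hq, hg⟩ := hg
  obtain ⟨-, hr, hf⟩ := hf
  refine ⟨hp, hr, fun x h₁ h₂ => ?_⟩
  have hx := hg x h₁ h₂
  have hp' : 0 < p.2 - p.1 := sub_pos.2 hp
  have hq' : 0 < q.2 - q.1 := sub_pos.2 hq
  have e : (g x : ℝ) = q.1 + (q.2 - q.1) * ((x - p.1) / (p.2 - p.1)) := by rw [hx]; ring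
  have h0 : 0 ≤ ((x : ℝ) - p.1) / (p.2 - p.1) := div_nonneg (sub_nonneg.2 h₁) hp'.le
  have h1 : ((x : ℝ) - p.1) / (p.2 - p.1) ≤ 1 := (div_le_one hp').2 (by linarith)
  have h := hf (g x) (by rw [e]; nlinarith) (by rw [e]; nlinarith)
  change (f (g x) : ℝ) = _
  rw [h, hx]
  field_simp
  ring

theorem forall₂_mapsInterval_comp {f g : unitInterval ≃o unitInterval} {l₁ l₂ l₃ : List (ℝ × ℝ)}
    (hf : List.Forall₂ (MapsInterval f) l₂ l₃) (hg : List.Forall₂ (MapsInterval g) l₁ l₂) :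
    List.Forall₂ (MapsInterval (f * g)) l₁ l₃ := by
  induction hg generalizing l₃ with
  | nil => cases hf; exact .nil
  | cons h _ ih =>
    cases hf with
    | cons h' hf => exact .cons (h'.comp h) (ih hf)

namespace BTree

/-- A homeomorphism that is affine on an interval carries each dyadic subdivision of it to the
subdivision of the image that belongs to the same tree. -/
theorem forall₂_intervals {g : unitInterval ≃o unitInterval} (S : BTree) {a b a' b' : ℝ}
    (h : MapsInterval g (a, b) (a', b')) :
    List.Forall₂ (MapsInterval g) (S.intervals a b) (S.intervals a' b') := by
  induction S generalizing a b a' b' with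
  | leaf => exact .cons h .nil
  | node l r hl hr =>
    obtain ⟨h₁, h₂, h⟩ := h
    simp only at h₁ h₂ h
    have hba : b - a ≠ 0 := by linarith
    have e₁ : ((a' + b') / 2 - a') / ((a + b) / 2 - a) = (b' - a') / (b - a) := by
      rw [div_eq_div_iff (by linarith) hba]; ring
    have e₂ : (b' - (a' + b') / 2) / (b - (a + b) / 2) = (b' - a') / (b - a) := by
      rw [div_eq_div_iff (by linarith) hba]; ring
    refine List.rel_append (hl ⟨by simp only; linarith, by simp only; linarith, ?_⟩)
      (hr ⟨by simp only; linarith, by simp only; linarith, ?_⟩)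
    · intro x hx hx'
      simp only at hx hx' ⊢
      rw [e₁]
      exact h x hx (by linarith)
    · intro x hx hx'
      simp only at hx hx' ⊢
      rw [e₂, h x (by linarith) hx']
      field_simp
      ring

theorem length_intervals (T : BTree) (a b : ℝ) : (T.intervals a b).length = T.numLeaves := by
  induction T generalizing a b with
  | leaf => rfl
  | node l r hl hr => simp [intervals, numLeaves, hl, hr]

theorem represents_of_forall₂ {Tp Tm : BTree} {g : thompsonF}
    (h : List.Forall₂ (MapsInterval g) (Tm.intervals 0 1) (Tp.intervals 0 1)) :
    Represents Tp Tm g := by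
  obtain ⟨h₁, h₂⟩ := List.forall₂_iff_zip.1 h
  rw [length_intervals, length_intervals] at h₁
  exact ⟨h₁.symm, fun p hp => (h₂ hp).2.2⟩

/-- The tree `S` hung below `n` carets along the right edge. -/
def prepend : ℕ → BTree → BTree
  | 0, S => S
  | n + 1, S => prepend n (node leaf S)

theorem prepend_node_leaf (n : ℕ) (S : BTree) :
    node leaf (prepend n S) = prepend n (node leaf S) := by
  induction n generalizing S with
  | zero => rfl
  | succ n ih => exact ih _

theorem prepend_leaf (n : ℕ) : prepend n leaf = comb n := by
  induction n with
  | zero => rfl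
  | succ n ih => rw [comb, ← ih, prepend_node_leaf]; rfl

/-- The carets above `S` in `prepend n S` contribute the same intervals for all `S`, and leave the
interval `[1 - 2⁻ⁿ, 1]` to `S`. -/
theorem intervals_prepend (n : ℕ) : ∃ L : List (ℝ × ℝ),
    (∀ p ∈ L, p.1 < p.2 ∧ p.2 ≤ 1 - (1 / 2) ^ n) ∧
      ∀ S, (prepend n S).intervals 0 1 = L ++ S.intervals (1 - (1 / 2) ^ n) 1 := by
  induction n with
  | zero => exact ⟨[], by simp, fun S => by simp [prepend]⟩
  | succ n ih =>
    obtain ⟨L, hL, hS⟩ := ih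
    have hd : (0 : ℝ) < (1 / 2) ^ n := by positivity
    have e : (1 - (1 / 2 : ℝ) ^ n + 1) / 2 = 1 - (1 / 2) ^ (n + 1) := by ring
    refine ⟨L ++ [(1 - (1 / 2) ^ n, 1 - (1 / 2) ^ (n + 1))], ?_, fun S => ?_⟩
    · have e' : (1 / 2 : ℝ) ^ (n + 1) = (1 / 2) ^ n / 2 := by ring
      intro p hp
      rcases List.mem_append.1 hp with hp | hp
      · exact ⟨(hL p hp).1, (hL p hp).2.trans (by rw [e']; linarith)⟩
      · rw [List.mem_singleton.1 hp]
        exact ⟨by simp only [e']; linarith, le_rfl⟩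
    · rw [prepend, hS, intervals, intervals, e, List.append_assoc]

/-- The generator `x_n` acts on trees by a rotation at the end of a right edge with `n` carets. -/
theorem forall₂_genIso (n : ℕ) (a b r : BTree) :
    List.Forall₂ (MapsInterval (genIso n)) ((prepend n (node a (node b r))).intervals 0 1)
      ((prepend n (node (node a b) r)).intervals 0 1) := by
  obtain ⟨L, hL, hS⟩ := intervals_prepend n
  rw [hS, hS]
  have hval : ∀ u : unitInterval, (genIso n u : ℝ) = genFun ((1 / 2) ^ n) u := fun _ => rfl
  have hd : (0 : ℝ) < (1 / 2) ^ n := by positivity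
  refine List.rel_append (List.forall₂_same.2 fun p hp => ?_) ?_
  · obtain ⟨h₁, h₂⟩ := hL p hp
    refine ⟨h₁, h₁, fun x _ hx => ?_⟩
    rw [hval, div_self (sub_pos.2 h₁).ne', genFun, if_pos (hx.trans h₂)]
    ring
  · generalize (1 / 2 : ℝ) ^ n = d at *
    simp only [intervals, List.append_assoc]
    refine List.rel_append (forall₂_intervals a ⟨?_, ?_, fun x hx hx' => ?_⟩) (List.rel_append
      (forall₂_intervals b ⟨?_, ?_, fun x hx hx' => ?_⟩)
      (forall₂_intervals r ⟨?_, ?_, fun x hx hx' => ?_⟩))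
    · simp only; linarith
    · simp only; linarith
    · simp only at hx hx' ⊢
      have e : ((1 - d + (1 - d + 1) / 2) / 2 - (1 - d)) / ((1 - d + 1) / 2 - (1 - d)) = 1 / 2 := by
        rw [div_eq_div_iff (by linarith) two_ne_zero]; ring
      rw [hval, e, genFun]
      split_ifs <;> linarith
    · simp only; linarith
    · simp only; linarith
    · simp only at hx hx' ⊢
      have e : ((1 - d + 1) / 2 - (1 - d + (1 - d + 1) / 2) / 2) /
          (((1 - d + 1) / 2 + 1) / 2 - (1 - d + 1) / 2) = 1 := by
        rw [div_eq_one_iff_eq (by linarith)]; ring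
      rw [hval, e, genFun]
      split_ifs <;> linarith
    · simp only; linarith
    · simp only; linarith
    · simp only at hx hx' ⊢
      have e : (1 - (1 - d + 1) / 2) / (1 - ((1 - d + 1) / 2 + 1) / 2) = 2 := by
        rw [div_eq_iff (by linarith)]; ring
      rw [hval, e, genFun]
      split_ifs <;> linarith

/-- Every tree is obtained from a comb by rotations at the right edge, so every pair with a comb as
its bottom tree represents a positive element. -/
theorem exists_mem_positiveMonoid (S : BTree) (n : ℕ) : ∃ g ∈ positiveMonoid,
    List.Forall₂ (MapsInterval g) ((comb (n + S.carets)).intervals 0 1)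
      ((prepend n S).intervals 0 1) := by
  -- If the left branch is `node a b`, the tree is the rotation by `x_n` of `node a (node b r)`,
  -- whose left branches `a` and `b` are smaller.
  have step : ∀ (l r : BTree), (∀ n, ∃ g ∈ positiveMonoid,
        List.Forall₂ (MapsInterval g) ((comb (n + r.carets)).intervals 0 1)
          ((prepend n r).intervals 0 1)) →
      ∀ n, ∃ g ∈ positiveMonoid,
        List.Forall₂ (MapsInterval g) ((comb (n + (node l r).carets)).intervals 0 1)
          ((prepend n (node l r)).intervals 0 1) := by
    intro l
    induction l with
    | leaf =>
      intro r hr n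
      obtain ⟨g, hg, h⟩ := hr (n + 1)
      refine ⟨g, hg, ?_⟩
      rwa [show n + (node leaf r).carets = n + 1 + r.carets by simp only [carets]; omega]
    | node a b ha hb =>
      intro r hr n
      obtain ⟨g, hg, h⟩ := ha _ (hb r hr) n
      refine ⟨thompsonGen n * g, mul_mem (Submonoid.subset_closure ⟨n, rfl⟩) hg, ?_⟩
      rw [show n + (node (node a b) r).carets = n + (node a (node b r)).carets by
        simp only [carets]; omega]
      exact forall₂_mapsInterval_comp (forall₂_genIso n a b r) h
  induction S generalizing n with
  | leaf =>
    refine ⟨1, one_mem _, ?_⟩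
    rw [prepend_leaf]
    refine forall₂_intervals _ ⟨by norm_num, by norm_num, fun x _ _ => ?_⟩
    simp
  | node l r _ hr => exact step l r hr n

theorem exists_represents (T : BTree) : ∃ g ∈ positiveMonoid, Represents T (comb T.carets) g := by
  obtain ⟨g, hg, h⟩ := T.exists_mem_positiveMonoid 0
  rw [zero_add] at h
  exact ⟨g, hg, represents_of_forall₂ h⟩

end BTree

/-! ### Thompson links and closures of bipartite trees -/

theorem mem_positiveThompsonLinks_iff {K : Link} : K ∈ positiveThompsonLinks ↔
    ∃ T : BTree, ∃ h : T.numLeaves = (BTree.comb T.carets).numLeaves,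
      (thompsonDiagram T (BTree.comb T.carets) h).toLink = K := by
  constructor
  · rintro ⟨g, -, T, k, h, rfl⟩
    obtain rfl : T.carets = k := by
      have := h.1
      rw [BTree.numLeaves_eq, BTree.numLeaves_eq, BTree.carets_comb] at this
      omega
    exact ⟨T, h.1, rfl⟩
  · rintro ⟨T, h, rfl⟩
    obtain ⟨g, hg, hT⟩ := T.exists_represents
    exact ⟨g, hg, T, T.carets, hT, rfl⟩

theorem BTree.toLink_thompsonDiagram (T : BTree) (t : WTree)
    (h : T.numLeaves = (BTree.comb T.carets).numLeaves)
    (ht : Eqv 0 (⟨0, .cup⟩ :: ⟨1, .cup⟩ :: (Word.shift 2 T.summands ++ [⟨1, .cap⟩, ⟨0, .cap⟩]))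
      (closureWord t.tangle)) :
    (thompsonDiagram T (BTree.comb T.carets) h).toLink = t.closure.toLink :=
  Eqv.toLink_eq (T.eqv_thompson.trans ht) _ _

theorem theorem1 : positiveThompsonLinks = bipartiteArborescentLinks := by
  ext K
  rw [mem_positiveThompsonLinks_iff]
  constructor
  · rintro ⟨T, h, rfl⟩
    refine ⟨.node (-1) (.node 1 [.node (-1) []] :: T.branches), ?_,
      (T.toLink_thompsonDiagram _ h T.eqv_closure_cons_branches.symm).symm⟩
    refine WTree.isBipartite_node fun t ht => ?_
    rcases List.mem_cons.1 ht with rfl | ht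
    · exact (WTree.isBipartite_node (by simp)).hang
    · exact T.branches_valid t ht
  · rintro ⟨t, ⟨hw, ht⟩, rfl⟩
    obtain ⟨S, rfl⟩ := (BTree.exists_bipartite_eq ht).1 hw
    have h : ((S.node .leaf).node .leaf).numLeaves =
        (BTree.comb ((S.node .leaf).node .leaf).carets).numLeaves := by
      rw [BTree.numLeaves_eq, BTree.numLeaves_eq, BTree.carets_comb]
    exact ⟨_, h, BTree.toLink_thompsonDiagram _ _ h S.eqv_closure_bipartite⟩
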